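/- Let $X$ be a simplicial group. Its Moore complex is $M_0=X_0$, $M_m=\bigcap_{i<m}\ker(d_i\colon X_m\to X_{m-1})$ for $m\ge 1$, with $\delta_m=d_m|_{M_m}\colon M_m\to M_{m-1}$, and $\pi_m(X)=\ker(\delta_m)/\delta_{m+1}(M_{m+1})$ (with $\ker\delta_0=M_0$); for $m\geq 1$ this group is abelian. For $k\ge 1$ let $\mu_{\ge k}(X)$ be the kernel of the unit $X\to \mathrm{Cosk}_{k-1}(X)$ of the adjunction $tr_{k-1}\dashv cosk_{k-1}$ between simplicial groups and $(k-1)$-truncated simplicial groups. For $k\ge 0$ let $\mathcal M_{k\ge}$ be the category of simplicial groups whose Moore complex is trivial in all degrees $>k$, let $\mathrm{Cot}_k$ be the reflector of simplicial groups onto $\mathcal M_{k\ge}$, and let $\mu_{k\ge}(X)$ be the kernel of the unit $X\to \mathrm{Cot}_k(X)$. These normal simplicial subgroups are ordered as $$\cdots\le\mu_{\ge k+1}(X)\le\mu_{k\ge}(X)\le\mu_{\ge k}(X)\le\cdots .$$ Put $$\Pi^{n\ge}_{\ge m}=\mu_{n\ge}/\mu_{\ge m},\quad \Pi^{n\ge}_{m\ge}=\mu_{n\ge}/\mu_{m\ge},\quad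 \Pi^{\ge n}_{\ge m}=\mu_{\ge n}/\mu_{\ge m},\quad \Pi^{\ge n}_{m\ge}=\mu_{\ge n}/\mu_{m\ge}$$ whenever the denominator is contained in the numerator by this order. For an abelian group $A$ and $p\ge 0$, a simplicial group $Y$ is a $K(A,p)$-simplicial group if $\pi_p(Y)\cong A$ and $\pi_i(Y)=0$ for all $i\ne p$. The standard Eilenberg–Mac Lane simplicial group is $K(A,p)=cosk_{p+1}(k(A,p))$, where $k(A,p)$ is the $(p+1)$-truncated simplicial group that is $0$ in degrees $<p$, $A$ in degree $p$ and $A^{p+1}$ in degree $p+1$, with faces $(d_0,\dots,d_{p+1})=(p_0,\,p_0+p_1,\,\dots,\,p_{p-1}+p_p,\,p_p)\colon A^{p+1}\to A$ (where $p_0,\dots,p_p$ are the projections) and with degeneracy $s_i\colon A\to A^{p+1}$ the inclusion of the $i$-th factor, $0\le i\le p$. **Corollary.** For every $n\ge 0$ and every simplicial group $X$, the simplicial groups $$\Pi^{n\ge}_{\ge n+2}(X),\quad \Pi^{n\ge}_{n+1\ge}(X),\quad \Pi^{\ge n+1}_{\ge n+2}(X),\quad \Pi^{\ge n+1}_{n+1\ge}(X)$$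 are $K(\pi_{n+1}(X),n+1)$-simplicial groups. Moreover, $\Pi^{\ge n+1}_{n+1\ge}(X)$ is isomorphic, as a simplicial group, to $K(\pi_{n+1}(X),n+1)$. -/

import Mathlib

open CategoryTheory Opposite

universe u

noncomputable section

namespace SimpGrp

/-- Simplicial groups. -/
abbrev SGrp : Type (u + 1) := SimplicialObject GrpCat.{u}

/-- The group of `m`-simplices. -/
abbrev grp (X : SGrp.{u}) (m : ℕ) : GrpCat.{u} := X.obj (op (SimplexCategory.mk m))

/-- The face homomorphism `d_i : X_{m+1} → X_m`. -/
def face (X : SGrp.{u}) {m : ℕ} (i : Fin (m + 2)) : grp X (m + 1) →* grp X m := (X.δ i).hom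

/-- The degeneracy homomorphism `s_i : X_m → X_{m+1}`. -/
def degen (X : SGrp.{u}) {m : ℕ} (i : Fin (m + 1)) : grp X m →* grp X (m + 1) := (X.σ i).hom

/-! ### Moore complex and homotopy groups -/

/-- The Moore complex: `M_0 = X_0` and `M_{m+1} = ⋂_{i ≤ m} ker (d_i : X_{m+1} → X_m)`, as
subgroups of the groups of simplices. -/
def moore (X : SGrp.{u}) : (m : ℕ) → Subgroup (grp X m)
  | 0 => ⊤
  | m + 1 => ⨅ i : Fin (m + 1), (face X i.castSucc).ker

/-- The cycles `ker (δ_m : M_m → M_{m-1})`, where `δ_m` is the restriction of the last face `d_m`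
(and `δ_0` is trivial). -/
def cycles (X : SGrp.{u}) : (m : ℕ) → Subgroup (grp X m)
  | 0 => ⊤
  | m + 1 => moore X (m + 1) ⊓ (face X (Fin.last (m + 1))).ker

/-- The boundaries `δ_{m+1}(M_{m+1})`. -/
def boundaries (X : SGrp.{u}) (m : ℕ) : Subgroup (grp X m) :=
  (moore X (m + 1)).map (face X (Fin.last (m + 1)))

theorem mem_moore_succ {X : SGrp.{u}} {m : ℕ} {x : grp X (m + 1)} :
    x ∈ moore X (m + 1) ↔ ∀ i : Fin (m + 1), face X i.castSucc x = 1 := by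
  simp [moore, Subgroup.mem_iInf, MonoidHom.mem_ker]

instance moore_normal (X : SGrp.{u}) (m : ℕ) : (moore X m).Normal := by
  cases m with
  | zero => exact inferInstanceAs (⊤ : Subgroup _).Normal
  | succ m => exact Subgroup.normal_iInf_normal fun i => inferInstance

theorem face_degen_castSucc (X : SGrp.{u}) {m : ℕ} (i : Fin (m + 1)) (x : grp X m) :
    face X i.castSucc (degen X i x) = x :=
  ConcreteCategory.congr_hom (X.δ_comp_σ_self (i := i)) x

theorem face_degen_succ (X : SGrp.{u}) {m : ℕ} (i : Fin (m + 1)) (x : grp X m) :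
    face X i.succ (degen X i x) = x :=
  ConcreteCategory.congr_hom (X.δ_comp_σ_succ (i := i)) x

theorem face_degen_of_le (X : SGrp.{u}) {m : ℕ} {i : Fin (m + 2)} {j : Fin (m + 1)}
    (h : i ≤ j.castSucc) (x : grp X (m + 1)) :
    face X i.castSucc (degen X j.succ x) = degen X j (face X i x) :=
  ConcreteCategory.congr_hom (X.δ_comp_σ_of_le h) x

theorem face_degen_of_gt (X : SGrp.{u}) {m : ℕ} {i : Fin (m + 2)} {j : Fin (m + 1)}
    (h : j.castSucc < i) (x : grp X (m + 1)) :
    face X i.succ (degen X j.castSucc x) = degen X j (face X i x) :=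
  ConcreteCategory.congr_hom (X.δ_comp_σ_of_gt h) x

instance boundaries_normal (X : SGrp.{u}) (m : ℕ) : (boundaries X m).Normal := by
  refine ⟨?_⟩
  rintro _ ⟨x, hx, rfl⟩ g
  refine ⟨degen X (Fin.last m) g * x * (degen X (Fin.last m) g)⁻¹,
    (moore_normal X (m + 1)).conj_mem x hx _, ?_⟩
  have := face_degen_succ X (Fin.last m) g
  rw [Fin.succ_last] at this
  simp [map_mul, this]

/-- The homotopy group `π_m(X)`: the homology `ker δ_m / δ_{m+1}(M_{m+1})` of the Moore complex. -/
abbrev homotopyGroup (X : SGrp.{u}) (m : ℕ) : Type u :=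
  cycles X m ⧸ (boundaries X m).subgroupOf (cycles X m)

theorem face_eq_one_of_mem_cycles {X : SGrp.{u}} {m : ℕ} {x : grp X (m + 1)}
    (hx : x ∈ cycles X (m + 1)) (i : Fin (m + 2)) : face X i x = 1 := by
  obtain ⟨h1, h2⟩ := hx
  induction i using Fin.lastCases with
  | last => exact h2
  | cast i => exact mem_moore_succ.1 h1 i

open scoped commutatorElement in
theorem commutator_mem_boundaries {X : SGrp.{u}} {m : ℕ} {x y : grp X (m + 1)}
    (hx : x ∈ cycles X (m + 1)) (hy : y ∈ cycles X (m + 1)) : ⁅x, y⁆ ∈ boundaries X (m + 1) := by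
  have hx' := face_eq_one_of_mem_cycles hx
  have hy' := face_eq_one_of_mem_cycles hy
  let l : Fin (m + 2) := Fin.last (m + 1)
  let p : Fin (m + 2) := (Fin.last m).castSucc
  have hlast : ∀ z : grp X (m + 1), (∀ i, face X i z = 1) →
      face X (Fin.last (m + 2)) (degen X p z) = 1 := by
    intro z hz
    have := face_degen_of_gt X (i := Fin.last (m + 1)) (j := Fin.last m)
      (Fin.castSucc_lt_last _) z
    rw [Fin.succ_last] at this
    rw [this, hz, map_one]
  have hlow : ∀ z : grp X (m + 1), (∀ i, face X i z = 1) → ∀ i : Fin (m + 1),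
      face X i.castSucc.castSucc (degen X l z) = 1 := by
    intro z hz i
    have := face_degen_of_le X (i := i.castSucc) (j := Fin.last m)
      (Fin.castSucc_le_castSucc_iff.2 (Fin.le_last i)) z
    rw [Fin.succ_last] at this
    rw [this, hz, map_one]
  have hl1 : ∀ z : grp X (m + 1), face X l.castSucc (degen X l z) = z :=
    fun z => face_degen_castSucc X l z
  have hl2 : ∀ z : grp X (m + 1), face X (Fin.last (m + 2)) (degen X l z) = z := fun z => by
    have := face_degen_succ X l z
    rwa [Fin.succ_last] at this
  have hp2 : ∀ z : grp X (m + 1), face X l.castSucc (degen X p z) = z := fun z => by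
    have := face_degen_succ X p z
    have e : p.succ = l.castSucc := by ext; simp [p, l]
    rwa [e] at this
  refine ⟨⁅degen X l x * (degen X p x)⁻¹, degen X l y⁆, ?_, ?_⟩
  · refine mem_moore_succ.2 fun i => ?_
    induction i using Fin.lastCases with
    | last =>
      change face X l.castSucc _ = 1
      rw [map_commutatorElement, map_mul, map_inv, hl1, hp2, mul_inv_cancel,
        commutatorElement_one_left]
    | cast i =>
      rw [map_commutatorElement, hlow y hy' i, commutatorElement_one_right]
  · rw [map_commutatorElement, map_mul, map_inv, hl2, hl2, hlast x hx', inv_one, mul_one]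

/-- The homotopy groups in positive degrees are abelian. -/
instance homotopyCommGroup (X : SGrp.{u}) (m : ℕ) : CommGroup (homotopyGroup X (m + 1)) :=
  { (inferInstance : Group (homotopyGroup X (m + 1))) with
    mul_comm := by
      intro a b
      induction a using QuotientGroup.induction_on with | H x => ?_
      induction b using QuotientGroup.induction_on with | H y => ?_
      rw [← QuotientGroup.mk_mul, ← QuotientGroup.mk_mul, QuotientGroup.eq,
        Subgroup.mem_subgroupOf]
      have := commutator_mem_boundaries ((cycles X (m + 1)).inv_mem y.2)
        ((cycles X (m + 1)).inv_mem x.2)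
      simpa [commutatorElement_def, mul_assoc] using this }

/-! ### Normal simplicial subgroups and quotients -/

/-- A normal simplicial subgroup of a simplicial group. -/
@[ext] structure NormalSub (X : SGrp.{u}) where
  sub : ∀ m, Subgroup (X.obj m)
  normal : ∀ m, (sub m).Normal
  map_mem : ∀ {m k} (f : m ⟶ k) {x : X.obj m}, x ∈ sub m → (X.map f).hom x ∈ sub k

attribute [instance] NormalSub.normal

namespace NormalSub

variable {X : SGrp.{u}}

instance : PartialOrder (NormalSub X) :=
  PartialOrder.lift NormalSub.sub fun _ _ h => NormalSub.ext h

/-- A normal simplicial subgroup, as a simplicial group. -/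
def toSGrp (R : NormalSub X) : SGrp.{u} where
  obj m := GrpCat.of (R.sub m)
  map {m k} f := GrpCat.ofHom
    (((X.map f).hom.comp (R.sub m).subtype).codRestrict (R.sub k) fun x => R.map_mem f x.2)
  map_id m := by ext x; simp
  map_comp f g := by ext x; simp

/-- The inclusion `R → X`. -/
def ι (R : NormalSub X) : R.toSGrp ⟶ X where
  app m := GrpCat.ofHom (R.sub m).subtype
  naturality _ _ _ := rfl

/-- The quotient simplicial group `X / R`. -/
def quotient (R : NormalSub X) : SGrp.{u} where
  obj m := GrpCat.of (X.obj m ⧸ R.sub m)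
  map {m k} f := GrpCat.ofHom
    (QuotientGroup.map (R.sub m) (R.sub k) (X.map f).hom fun _ hx => R.map_mem f hx)
  map_id m := by
    refine ConcreteCategory.hom_ext _ _ fun x => ?_
    refine QuotientGroup.induction_on x fun y => ?_
    exact congrArg (QuotientGroup.mk (s := R.sub m)) (ConcreteCategory.congr_hom (X.map_id m) y)
  map_comp {a b c} f g := by
    refine ConcreteCategory.hom_ext _ _ fun x => ?_
    refine QuotientGroup.induction_on x fun y => ?_
    exact congrArg (QuotientGroup.mk (s := R.sub c)) (ConcreteCategory.congr_hom (X.map_comp f g) y)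

/-- The projection `X → X / R`. -/
def π (R : NormalSub X) : X ⟶ R.quotient where
  app m := GrpCat.ofHom (QuotientGroup.mk' (R.sub m))
  naturality _ _ _ := rfl

/-- For `τ ≤ σ`, the simplicial subgroup `τ` regarded as a normal simplicial subgroup of `σ`. -/
def restrict (τ σ : NormalSub X) (_ : τ ≤ σ) : NormalSub σ.toSGrp where
  sub m := (τ.sub m).subgroupOf (σ.sub m)
  normal m := inferInstanceAs ((τ.sub m).subgroupOf (σ.sub m)).Normal
  map_mem f _ hx := τ.map_mem f hx

/-- For normal simplicial subgroups `τ ≤ σ` of `X`, the simplicial group `σ / τ`. -/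
def subquotient (σ τ : NormalSub X) (h : τ ≤ σ) : SGrp.{u} := (restrict τ σ h).quotient

end NormalSub

/-- The kernel of a morphism of simplicial groups. -/
def kernel {X Y : SGrp.{u}} (f : X ⟶ Y) : NormalSub X where
  sub m := (f.app m).hom.ker
  normal m := inferInstance
  map_mem {m k} g x hx := by
    have := ConcreteCategory.congr_hom (f.naturality g) x
    rw [MonoidHom.mem_ker] at hx ⊢
    refine this.trans ?_
    change (Y.map g).hom ((f.app m).hom x) = 1
    rw [hx, map_one]

theorem mem_kernel {X Y : SGrp.{u}} (f : X ⟶ Y) {m} {x : X.obj m} :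
    x ∈ (kernel f).sub m ↔ (f.app m).hom x = 1 := Iff.rfl

/-! ### The radical `μ_{≥ n}` -/

/-- The unit `X → Cosk_n(X)` of the adjunction `tr_n ⊣ cosk_n`. -/
def coskUnit (n : ℕ) (X : SGrp.{u}) :
    X ⟶ (SimplicialObject.Truncated.cosk n).obj ((SimplicialObject.truncation n).obj X) :=
  (SimplicialObject.coskAdj n).unit.app X

/-- The idempotent radical `μ_{≥ n}` of the torsion theory in simplicial groups whose torsion
objects are those that are trivial below degree `n`: for `n ≥ 1`, `μ_{≥ n}(X)` is the kernel
of `X → Cosk_{n-1}(X)`; for `n = 0` the condition is empty and `μ_{≥ 0}(X) = X`. -/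
def muGE : ℕ → (X : SGrp.{u}) → NormalSub X
  | 0, _ => ⟨fun _ => ⊤, fun _ => inferInstance, fun _ _ _ => trivial⟩
  | n + 1, X => kernel (coskUnit n X)

/-! ### Cotruncation and the radical `μ_{n ≥}` -/

/-- The class `M_{n ≥}` of simplicial groups whose Moore complex is trivial above degree `n`. -/
def MooreTrivialAbove (n : ℕ) (X : SGrp.{u}) : Prop := ∀ i, n < i → moore X i = ⊥

/-- The least normal simplicial subgroup of `X` with quotient in `M_{n ≥}`. -/
def cotSub (n : ℕ) (X : SGrp.{u}) : NormalSub X where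
  sub m := ⨅ R : {R : NormalSub X // MooreTrivialAbove n R.quotient}, R.1.sub m
  normal m := Subgroup.normal_iInf_normal fun R => R.1.normal m
  map_mem f x hx := by
    simp only [Subgroup.mem_iInf] at hx ⊢
    exact fun R => R.1.map_mem f (hx R)

/-- The cotruncation `Cot_n(X)`: the reflection of `X` in `M_{n ≥}`. -/
def Cot (n : ℕ) (X : SGrp.{u}) : SGrp.{u} := (cotSub n X).quotient

/-- The unit `X → Cot_n(X)` of the reflection. -/
def cotUnit (n : ℕ) (X : SGrp.{u}) : X ⟶ Cot n X := (cotSub n X).π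

theorem mk_mem_moore_succ {X : SGrp.{u}} {R : NormalSub X} {m : ℕ} {x : grp X (m + 1)} :
    (QuotientGroup.mk x : _ ⧸ R.sub (op (SimplexCategory.mk (m + 1)))) ∈ moore R.quotient (m + 1) ↔
      ∀ i : Fin (m + 1), face X i.castSucc x ∈ R.sub (op (SimplexCategory.mk m)) := by
  refine mem_moore_succ.trans (forall_congr' fun i => ?_)
  exact QuotientGroup.eq_one_iff _

theorem mooreTrivialAbove_quotient_iff {n : ℕ} {X : SGrp.{u}} {R : NormalSub X} :
    MooreTrivialAbove n R.quotient ↔ ∀ m, n ≤ m → ∀ x : grp X (m + 1),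
      (∀ i : Fin (m + 1), face X i.castSucc x ∈ R.sub (op (SimplexCategory.mk m))) →
        x ∈ R.sub (op (SimplexCategory.mk (m + 1))) := by
  constructor
  · intro h m hm x hx
    have h1 := mk_mem_moore_succ.2 hx
    rw [h (m + 1) (by omega)] at h1
    exact (QuotientGroup.eq_one_iff _).1 (Subgroup.mem_bot.1 h1)
  · intro h i hi
    obtain ⟨m, rfl⟩ : ∃ m, i = m + 1 := ⟨i - 1, by omega⟩
    refine (Subgroup.eq_bot_iff_forall _).2 fun x => ?_
    induction x using QuotientGroup.induction_on with | H x => ?_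
    exact fun hx => (QuotientGroup.eq_one_iff _).2 (h m (by omega) x (mk_mem_moore_succ.1 hx))

theorem cotSub_le {n : ℕ} {X : SGrp.{u}} {R : NormalSub X} (h : MooreTrivialAbove n R.quotient) :
    cotSub n X ≤ R :=
  fun _ => iInf_le (fun R : {R : NormalSub X // MooreTrivialAbove n R.quotient} => R.1.sub _) ⟨R, h⟩

theorem cot_mem (n : ℕ) (X : SGrp.{u}) : MooreTrivialAbove n (Cot n X) := by
  refine mooreTrivialAbove_quotient_iff.2 fun m hm x hx => Subgroup.mem_iInf.2 fun R => ?_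
  exact mooreTrivialAbove_quotient_iff.1 R.2 m hm x fun i => cotSub_le R.2 _ (hx i)

/-- `Cot_n(X)` is the reflection of `X` in `M_{n ≥}`. -/
theorem cot_universal (n : ℕ) {X Y : SGrp.{u}} (hY : MooreTrivialAbove n Y) (f : X ⟶ Y) :
    ∃! g : Cot n X ⟶ Y, cotUnit n X ≫ g = f := by
  have hk : cotSub n X ≤ kernel f := by
    refine cotSub_le (mooreTrivialAbove_quotient_iff.2 fun m hm x hx => ?_)
    have h1 : (f.app _).hom x ∈ moore Y (m + 1) := by
      refine mem_moore_succ.2 fun i => ?_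
      have := ConcreteCategory.congr_hom (f.naturality (SimplexCategory.δ i.castSucc).op) x
      exact this.symm.trans (hx i)
    rw [hY (m + 1) (by omega)] at h1
    exact h1
  refine ⟨{ app := fun m => GrpCat.ofHom (QuotientGroup.lift _ (f.app m).hom (hk m))
            naturality := ?_ }, ?_, ?_⟩
  · intro m k g
    ext x
    induction x using QuotientGroup.induction_on with | H x => ?_
    exact ConcreteCategory.congr_hom (f.naturality g) x
  · rfl
  · rintro g rfl
    ext m x
    induction x using QuotientGroup.induction_on with | H x => rfl

/-- The idempotent radical `μ_{n ≥}` of the torsion theory `(Ker(Cot_n), M_{n ≥})` in simplicial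
groups: the kernel of `X → Cot_n(X)`. -/
def muLE (n : ℕ) (X : SGrp.{u}) : NormalSub X := kernel (cotUnit n X)

/-! ### The linear order of the radicals

`... ≤ μ_{n+1 ≥} ≤ μ_{≥ n+1} ≤ μ_{n ≥} ≤ μ_{≥ n} ≤ ...` -/

theorem muLE_eq (n : ℕ) (X : SGrp.{u}) : muLE n X = cotSub n X :=
  NormalSub.ext (funext fun _ => QuotientGroup.ker_mk' _)

theorem mem_muGE {n : ℕ} {X : SGrp.{u}} {m : SimplexCategoryᵒᵖ} {x : X.obj m} :
    x ∈ (muGE n X).sub m ↔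
      ∀ (k : ℕ), k < n → ∀ θ : m ⟶ op (SimplexCategory.mk k), (X.map θ).hom x = 1 := by
  cases n with
  | zero => exact ⟨fun _ k hk => absurd hk (Nat.not_lt_zero k), fun _ => trivial⟩
  | succ n =>
    constructor
    · intro hx k hk θ
      have h1 := (kernel (coskUnit n X)).map_mem θ hx
      rw [mem_kernel] at h1
      have h2 := congrArg (fun φ => φ.app (op ⟨SimplexCategory.mk k, Nat.le_of_lt_succ hk⟩))
        ((SimplicialObject.coskAdj (C := GrpCat.{u}) n).left_triangle_components X)
      have h3 := ConcreteCategory.congr_hom h2 ((X.map θ).hom x)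
      refine h3.symm.trans ?_
      refine (congrArg (((SimplicialObject.coskAdj (C := GrpCat.{u}) n).counit.app _).app
        (op ⟨SimplexCategory.mk k, Nat.le_of_lt_succ hk⟩)).hom h1).trans ?_
      exact map_one _
    · intro hx
      let K : NormalSub X :=
        { sub := fun m => ⨅ (k : {k : ℕ // k < n + 1}), ⨅ (θ : m ⟶ op (SimplexCategory.mk k.1)),
            (X.map θ).hom.ker
          normal := fun m => Subgroup.normal_iInf_normal fun k =>
            Subgroup.normal_iInf_normal fun θ => inferInstance
          map_mem := by
            intro m l f x hx
            simp only [Subgroup.mem_iInf, MonoidHom.mem_ker] at hx ⊢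
            intro k θ
            have := hx k (f ≫ θ)
            rwa [X.map_comp] at this }
      have hxK : x ∈ K.sub m := by
        simp only [K, Subgroup.mem_iInf, MonoidHom.mem_ker]
        exact fun k => hx k.1 k.2
      let one : K.toSGrp ⟶ (SimplicialObject.Truncated.cosk n).obj
          ((SimplicialObject.truncation n).obj X) :=
        { app := fun m => GrpCat.ofHom 1
          naturality := fun _ _ f => ConcreteCategory.hom_ext _ _ fun _ => (map_one (((SimplicialObject.Truncated.cosk n).obj
              ((SimplicialObject.truncation n).obj X)).map f).hom).symm }
      have key : K.ι ≫ coskUnit n X = one := by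
        apply ((SimplicialObject.coskAdj (C := GrpCat.{u}) n).homEquiv _ _).symm.injective
        ext k z
        have hz : z = 1 := by
          apply Subtype.ext
          have := z.2
          simp only [K, Subgroup.mem_iInf, MonoidHom.mem_ker] at this
          have h := this ⟨k.unop.obj.len, Nat.lt_succ_of_le k.unop.property⟩ (𝟙 _)
          erw [X.map_id] at h
          exact h
        rw [hz]
        exact (map_one _).trans (map_one _).symm
      exact ConcreteCategory.congr_hom (congrArg (fun φ => φ.app m) key) ⟨x, hxK⟩

theorem muGE_anti {n m : ℕ} (h : n ≤ m) (X : SGrp.{u}) : muGE m X ≤ muGE n X :=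
  fun _ _ hx => mem_muGE.2 fun k hk => mem_muGE.1 hx k (lt_of_lt_of_le hk h)

theorem muLE_anti {n m : ℕ} (h : n ≤ m) (X : SGrp.{u}) : muLE m X ≤ muLE n X := by
  rw [muLE_eq, muLE_eq]
  exact cotSub_le fun i hi => cot_mem n X i (lt_of_le_of_lt h hi)

theorem muLE_le_muGE (n : ℕ) (X : SGrp.{u}) : muLE n X ≤ muGE n X := by
  rw [muLE_eq]
  refine cotSub_le (mooreTrivialAbove_quotient_iff.2 fun m hm x hx => mem_muGE.2 fun k hk θ => ?_)
  obtain ⟨i, hi⟩ : ∃ i : Fin (m + 1), ∀ t, SimplexCategory.Hom.toOrderHom θ.unop t ≠ i.castSucc := by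
    by_contra! hcon
    choose g hg using hcon
    have hinj : Function.Injective g := fun a b hab => by
      have := (hg a).symm.trans ((congrArg _ hab).trans (hg b))
      exact Fin.castSucc_injective _ this
    have := Fintype.card_le_of_injective g hinj
    simp at this
    omega
  obtain ⟨θ', hθ'⟩ := SimplexCategory.eq_comp_δ_of_not_surjective' θ.unop i.castSucc hi
  have h1 := mem_muGE.1 (hx i) k hk θ'.op
  have h2 : θ = (SimplexCategory.δ i.castSucc).op ≫ θ'.op := Quiver.Hom.unop_inj hθ'
  rw [h2, X.map_comp]
  exact h1

theorem muGE_succ_le_muLE (n : ℕ) (X : SGrp.{u}) : muGE (n + 1) X ≤ muLE n X := by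
  rw [muLE_eq]
  intro m x hx
  refine Subgroup.mem_iInf.2 fun R => ?_
  suffices H : ∀ (l : ℕ) (x : grp X l), x ∈ (muGE (n + 1) X).sub _ → x ∈ R.1.sub _ from
    H m.unop.len x hx
  intro l
  induction l with
  | zero =>
    intro x hx
    have h := mem_muGE.1 hx 0 (by omega) (𝟙 _)
    rw [X.map_id] at h
    have h : x = 1 := h
    rw [h]; exact one_mem _
  | succ l ih =>
    intro x hx
    by_cases hl : l + 1 ≤ n
    · have h := mem_muGE.1 hx (l + 1) (by omega) (𝟙 _)
      rw [X.map_id] at h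
      have h : x = 1 := h
      rw [h]; exact one_mem _
    · exact mooreTrivialAbove_quotient_iff.1 R.2 l (by omega) x fun i =>
        ih _ ((muGE (n + 1) X).map_mem _ hx)

/-! ### The fundamental simplicial groups -/

/-- `Π^{n ≥}_{≥ m}(X) = μ_{n ≥}(X) / μ_{≥ m}(X)`, for `m > n`. -/
def piLEGE (n m : ℕ) (h : n < m) (X : SGrp.{u}) : SGrp.{u} :=
  (muLE n X).subquotient (muGE m X) ((muGE_anti h X).trans (muGE_succ_le_muLE n X))

/-- `Π^{n ≥}_{m ≥}(X) = μ_{n ≥}(X) / μ_{m ≥}(X)`, for `m ≥ n`. -/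
def piLELE (n m : ℕ) (h : n ≤ m) (X : SGrp.{u}) : SGrp.{u} :=
  (muLE n X).subquotient (muLE m X) (muLE_anti h X)

/-- `Π^{≥ n}_{≥ m}(X) = μ_{≥ n}(X) / μ_{≥ m}(X)`, for `m ≥ n`. -/
def piGEGE (n m : ℕ) (h : n ≤ m) (X : SGrp.{u}) : SGrp.{u} :=
  (muGE n X).subquotient (muGE m X) (muGE_anti h X)

/-- `Π^{≥ n}_{m ≥}(X) = μ_{≥ n}(X) / μ_{m ≥}(X)`, for `m ≥ n`. -/
def piGELE (n m : ℕ) (h : n ≤ m) (X : SGrp.{u}) : SGrp.{u} :=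
  (muGE n X).subquotient (muLE m X) ((muLE_anti h X).trans (muLE_le_muGE n X))

/-! ### Eilenberg–Mac Lane simplicial groups -/

/-- `X` is a `K(A, n)`-simplicial group: `π_n(X) ≅ A` and all other homotopy groups are trivial. -/
def IsEilenbergMacLane (A : Type u) [CommGroup A] (n : ℕ) (X : SGrp.{u}) : Prop :=
  Nonempty (homotopyGroup X n ≃* A) ∧ ∀ i, i ≠ n → Subsingleton (homotopyGroup X i)

/-- The surjective monotone maps `[m] → [n]`. -/
abbrev Surj (m : SimplexCategory) (n : ℕ) : Type :=
  {σ : m ⟶ SimplexCategory.mk n // Function.Surjective (SimplexCategory.Hom.toOrderHom σ)}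

instance (m : SimplexCategory) (n : ℕ) : Fintype (Surj m n) := Fintype.ofFinite _

/-- The homomorphism `A^{Surj(m, n)} → A^{Surj(k, n)}` given by `θ : [k] → [m]`: it sends the
copy of `A` indexed by `σ` identically to the copy indexed by `σ ∘ θ` if that map is surjective,
and to the trivial element if it is not. -/
def surjMap (A : Type u) [CommGroup A] (n : ℕ) {k m : SimplexCategory} (θ : k ⟶ m) :
    (Surj m n → A) →* (Surj k n → A) where
  toFun f τ := ∏ σ : Surj m n, if θ ≫ σ.1 = τ.1 then f σ else 1
  map_one' := by ext τ; simp
  map_mul' f g := by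
    ext τ
    simp only [Pi.mul_apply, ← Finset.prod_mul_distrib]
    exact Finset.prod_congr rfl fun σ _ => by split_ifs <;> simp

theorem surjMap_id (A : Type u) [CommGroup A] (n : ℕ) (m : SimplexCategory) :
    surjMap A n (𝟙 m) = MonoidHom.id _ := by
  refine MonoidHom.ext fun f => funext fun τ => ?_
  change (∏ σ : Surj m n, if 𝟙 m ≫ σ.1 = τ.1 then f σ else 1) = f τ
  simp only [Category.id_comp, ← Subtype.ext_iff]
  simp

theorem surjMap_comp (A : Type u) [CommGroup A] (n : ℕ) {l k m : SimplexCategory} (η : l ⟶ k)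
    (θ : k ⟶ m) : surjMap A n (η ≫ θ) = (surjMap A n η).comp (surjMap A n θ) := by
  refine MonoidHom.ext fun f => funext fun τ => ?_
  change (∏ σ : Surj m n, if (η ≫ θ) ≫ σ.1 = τ.1 then f σ else 1) =
    ∏ ρ : Surj k n, if η ≫ ρ.1 = τ.1 then (∏ σ : Surj m n, if θ ≫ σ.1 = ρ.1 then f σ else 1) else 1
  have h1 : ∀ ρ : Surj k n,
      (if η ≫ ρ.1 = τ.1 then (∏ σ : Surj m n, if θ ≫ σ.1 = ρ.1 then f σ else 1) else 1) =
      ∏ σ : Surj m n, if η ≫ ρ.1 = τ.1 ∧ θ ≫ σ.1 = ρ.1 then f σ else 1 := by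
    intro ρ
    by_cases h : η ≫ ρ.1 = τ.1 <;> simp [h]
  simp_rw [h1]
  rw [Finset.prod_comm]
  refine Finset.prod_congr rfl fun σ _ => ?_
  by_cases h : (η ≫ θ) ≫ σ.1 = τ.1
  · have hs : Function.Surjective (SimplexCategory.Hom.toOrderHom (θ ≫ σ.1)) := by
      have := τ.2
      rw [← h, Category.assoc] at this
      intro y
      obtain ⟨x, hx⟩ := this y
      exact ⟨SimplexCategory.Hom.toOrderHom η x, hx⟩
    rw [if_pos h, Finset.prod_eq_single (⟨θ ≫ σ.1, hs⟩ : Surj k n)]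
    · simp [← h]
    · intro ρ _ hρ
      rw [if_neg]
      rintro ⟨_, h2⟩
      exact hρ (Subtype.ext h2.symm)
    · simp
  · rw [if_neg h]
    symm
    refine Finset.prod_eq_one fun ρ _ => if_neg ?_
    rintro ⟨h2, h3⟩
    exact h (by rw [Category.assoc, h3, h2])

/-- The `(n+1)`-truncated simplicial group `k(A, n)`. In degree `m ≤ n + 1` it is the power of `A`
indexed by the surjective monotone maps `[m] → [n]`; so it is trivial in degrees below `n`, it is
`A` in degree `n` and `A^{n+1}` in degree `n + 1`, where the `j`-th factor, `0 ≤ j ≤ n`, is indexed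
by the surjection `σ_j` that takes the value `j` twice. The faces `A^{n+1} → A` are
`(d_0, ..., d_{n+1}) = (p_0, p_0 + p_1, ..., p_{n-1} + p_n, p_n)` and the degeneracy `s_i` is
the inclusion of the `i`-th factor: see the lemmas below. -/
def truncEM (A : Type u) [CommGroup A] (n : ℕ) :
    SimplicialObject.Truncated GrpCat.{u} (n + 1) where
  obj m := GrpCat.of (Surj m.unop.obj n → A)
  map f := GrpCat.ofHom (surjMap A n ((SimplexCategory.Truncated.inclusion (n + 1)).map f.unop))
  map_id m := by
    rw [unop_id, CategoryTheory.Functor.map_id]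
    exact congrArg GrpCat.ofHom (surjMap_id A n _)
  map_comp f g := by
    rw [unop_comp, CategoryTheory.Functor.map_comp]
    exact congrArg GrpCat.ofHom (surjMap_comp A n _ _)

/-- The Eilenberg–Mac Lane simplicial group `K(A, n) = cosk_{n+1}(k(A, n))`. -/
def EilenbergMacLane (A : Type u) [CommGroup A] (n : ℕ) : SGrp.{u} :=
  (SimplicialObject.Truncated.cosk (n + 1)).obj (truncEM A n)

/-- The identity of `[n]`, as a surjection. -/
def Surj.one (n : ℕ) : Surj (SimplexCategory.mk n) n := ⟨𝟙 _, fun y => ⟨y, rfl⟩⟩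

/-- The surjection `σ_j : [n+1] → [n]`. -/
def Surj.σ {n : ℕ} (j : Fin (n + 1)) : Surj (SimplexCategory.mk (n + 1)) n :=
  ⟨SimplexCategory.σ j, SimplexCategory.epi_iff_surjective.1 inferInstance⟩

theorem Surj.isEmpty {m n : ℕ} (h : m < n) : IsEmpty (Surj (SimplexCategory.mk m) n) :=
  ⟨fun σ => by
    have := Fintype.card_le_of_surjective _ σ.2
    simp at this
    omega⟩

theorem Surj.eq_one {n : ℕ} (σ : Surj (SimplexCategory.mk n) n) : σ = Surj.one n :=
  Subtype.ext (by
    have : Epi σ.1 := SimplexCategory.epi_iff_surjective.2 σ.2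
    exact SimplexCategory.eq_id_of_epi σ.1)

theorem Surj.σ_bijective (n : ℕ) : Function.Bijective (Surj.σ (n := n)) := by
  constructor
  · intro i j h
    exact SimplexCategory.σ_injective (congrArg Subtype.val h)
  · intro τ
    have : Epi τ.1 := SimplexCategory.epi_iff_surjective.2 τ.2
    obtain ⟨i, hi⟩ := SimplexCategory.eq_σ_of_epi τ.1
    exact ⟨i, Subtype.ext hi.symm⟩

theorem δ_comp_σ_eq_id_iff {n : ℕ} (i : Fin (n + 2)) (j : Fin (n + 1)) :
    SimplexCategory.δ i ≫ SimplexCategory.σ j = 𝟙 _ ↔ i = j.castSucc ∨ i = j.succ := by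
  constructor
  · intro h
    by_contra! hne
    obtain ⟨a, ha⟩ := Fin.exists_succAbove_eq hne.1.symm
    obtain ⟨b, hb⟩ := Fin.exists_succAbove_eq hne.2.symm
    have hv : ∀ t : Fin (n + 1), j.predAbove (i.succAbove t) = t := fun t =>
      congrArg (fun φ => SimplexCategory.Hom.toOrderHom φ t) h
    have h1 := hv a
    have h2 := hv b
    rw [ha, Fin.predAbove_castSucc_self] at h1
    rw [hb, Fin.predAbove_succ_self] at h2
    rw [← h1] at ha
    rw [← h2, ha] at hb
    exact (Fin.castSucc_lt_succ (i := j)).ne hb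
  · rintro (rfl | rfl)
    · exact SimplexCategory.δ_comp_σ_self
    · exact SimplexCategory.δ_comp_σ_succ

/-- The degeneracy `s_i : A → A^{n+1}` of `k(A, n)`. -/
theorem surjMap_σ (A : Type u) [CommGroup A] {n : ℕ} (i j : Fin (n + 1))
    (a : Surj (SimplexCategory.mk n) n → A) :
    surjMap A n (SimplexCategory.σ i) a (Surj.σ j) = if j = i then a (Surj.one n) else 1 := by
  change (∏ τ : Surj (SimplexCategory.mk n) n,
    if SimplexCategory.σ i ≫ τ.1 = SimplexCategory.σ j then a τ else 1) = _
  rw [Fintype.prod_eq_single (Surj.one n) fun τ h => absurd τ.eq_one h]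
  simp only [Surj.one, Category.comp_id, SimplexCategory.σ_injective.eq_iff, eq_comm]

/-- The face `d_i : A^{n+1} → A` of `k(A, n)`. -/
theorem surjMap_δ (A : Type u) [CommGroup A] {n : ℕ} (i : Fin (n + 2))
    (f : Surj (SimplexCategory.mk (n + 1)) n → A) :
    surjMap A n (SimplexCategory.δ i) f (Surj.one n) =
      ∏ j : Fin (n + 1), if i = j.castSucc ∨ i = j.succ then f (Surj.σ j) else 1 := by
  change (∏ τ : Surj (SimplexCategory.mk (n + 1)) n,
    if SimplexCategory.δ i ≫ τ.1 = 𝟙 _ then f τ else 1) = _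
  rw [← (Surj.σ_bijective n).prod_comp]
  refine Finset.prod_congr rfl fun j _ => ?_
  simp only [Surj.σ, δ_comp_σ_eq_id_iff]

end SimpGrp

end

noncomputable section

namespace SimpGrp

/-! ### Faces and operators that miss a vertex -/

/-! Write M, Z, B for the Moore complex, cycles and boundaries of X. The Moore complex is exact on
quotients: a simplex whose lower faces lie in a normal simplicial subgroup R can be multiplied by an
element of R so that it lands in M (`exists_mul_mem_moore`). So everything reduces to the Moore
complexes of the radicals. That of `μ_{≥ n}` is 0 below n, Z_n in degree n and M_m above. That of
`μ_{n ≥}` is 0 below n, B_n in degree n and M_m above; the bound by B_n comes from `boundarySub`, a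
normal simplicial subgroup with quotient in `M_{n ≥}`.

In degrees n+2, n+1, n the four quotients therefore have Moore complexes B_{n+1} → M_{n+1} → B_n,
then 0 → M_{n+1}/B_{n+1} → B_n, then B_{n+1} → Z_{n+1} → 0, and finally Z_{n+1}/B_{n+1} alone. In
each of them the only homology is Z_{n+1}/B_{n+1}, in degree n+1; `isEilenbergMacLane_subquotient`
treats all four at once.

The last quotient has its Moore complex in one degree only. A morphism between simplicial groups
with Moore complex trivial above N is an isomorphism once it is bijective up to degree N
(`isIso_of_bijective`). This is used twice, through the explicit model `surjEM` with A^{Surj(m, p)}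
in degree m: its unit to the coskeleton identifies it with K(A, p), and the operators indexed by
surjections map it isomorphically to the quotient. -/

theorem exists_map_eq_map_face (X : SGrp.{u}) {m : ℕ} {k : SimplexCategoryᵒᵖ} (i : Fin (m + 2))
    (θ : op (SimplexCategory.mk (m + 1)) ⟶ k)
    (h : ∀ t, SimplexCategory.Hom.toOrderHom θ.unop t ≠ i) :
    ∃ θ' : op (SimplexCategory.mk m) ⟶ k, ∀ x : grp X (m + 1),
      (X.map θ).hom x = (X.map θ').hom (face X i x) := by
  induction k using Opposite.rec with | op k => ?_
  induction k using SimplexCategory.rec with | _ k => ?_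
  obtain ⟨θ', hθ'⟩ := SimplexCategory.eq_comp_δ_of_not_surjective' θ.unop i h
  refine ⟨θ'.op, fun x => ?_⟩
  have h2 : θ = (SimplexCategory.δ i).op ≫ θ'.op := Quiver.Hom.unop_inj hθ'
  rw [h2, X.map_comp]
  rfl

/-- The k + 1 values of θ cannot cover the m + 1 vertices other than the last. This is why operators
that drop the degree by at least two factor through a lower face. -/
theorem exists_castSucc_not_mem_range {k m : ℕ} (h : k < m)
    (θ : SimplexCategory.mk k ⟶ SimplexCategory.mk (m + 1)) :
    ∃ i : Fin (m + 1), ∀ t, SimplexCategory.Hom.toOrderHom θ t ≠ i.castSucc := by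
  by_contra! hcon
  choose g hg using hcon
  have hinj : Function.Injective g := fun a b hab =>
    Fin.castSucc_injective _ ((hg a).symm.trans ((congrArg _ hab).trans (hg b)))
  have := Fintype.card_le_of_injective g hinj
  simp at this
  omega

/-- A monotone map `[m] → [m+1]` misses a vertex other than the last one, or is the last
coface. -/
theorem eq_δ_last_or_exists_castSucc {m : ℕ}
    (θ : SimplexCategory.mk m ⟶ SimplexCategory.mk (m + 1)) :
    θ = SimplexCategory.δ (Fin.last (m + 1)) ∨
      ∃ i : Fin (m + 1), ∀ t, SimplexCategory.Hom.toOrderHom θ t ≠ i.castSucc := by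
  by_contra! hcon
  obtain ⟨h1, h2⟩ := hcon
  choose g hg using h2
  have hinj : Function.Injective g := fun a b hab =>
    Fin.castSucc_injective _ ((hg a).symm.trans ((congrArg _ hab).trans (hg b)))
  -- A θ that hits every vertex but possibly the last has no values left for the last one. So it
  -- factors through the last coface, by an injective endomorphism of [m], which is the identity.
  have hbij : Function.Bijective g := Finite.injective_iff_bijective.1 hinj
  have hlast : ∀ t, SimplexCategory.Hom.toOrderHom θ t ≠ Fin.last (m + 1) := by
    intro t ht
    obtain ⟨s, hs⟩ := hbij.2 t
    have h3 := hg s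
    rw [hs, ht] at h3
    exact (Fin.castSucc_lt_last s).ne h3.symm
  obtain ⟨θ', hθ'⟩ := SimplexCategory.eq_comp_δ_of_not_surjective' θ _ hlast
  have : Mono θ := by
    refine SimplexCategory.mono_iff_injective.2 fun a b hab => ?_
    obtain ⟨a, rfl⟩ := hbij.2 a
    obtain ⟨b, rfl⟩ := hbij.2 b
    rw [hg, hg] at hab
    rw [Fin.castSucc_injective _ hab]
  have : Mono θ' := by
    rw [hθ'] at this
    exact mono_of_mono θ' (SimplexCategory.δ (Fin.last (m + 1)))
  rw [SimplexCategory.eq_id_of_mono θ', Category.id_comp] at hθ'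
  exact h1 hθ'

/-- Operators that lower the degree by at least two vanish on the Moore complex. -/
theorem map_eq_one_of_mem_moore {X : SGrp.{u}} {m : ℕ} {x : grp X (m + 1)}
    (hx : x ∈ moore X (m + 1)) {k : SimplexCategoryᵒᵖ} (θ : op (SimplexCategory.mk (m + 1)) ⟶ k)
    (h : k.unop.len < m) : (X.map θ).hom x = 1 := by
  induction k using Opposite.rec with | op k => ?_
  induction k using SimplexCategory.rec with | _ k => ?_
  obtain ⟨i, hi⟩ := exists_castSucc_not_mem_range h θ.unop
  obtain ⟨θ', hθ'⟩ := exists_map_eq_map_face X _ θ hi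
  rw [hθ', mem_moore_succ.1 hx i, map_one]

theorem map_eq_one_of_mem_cycles {X : SGrp.{u}} {m : ℕ} {x : grp X m}
    (hx : x ∈ cycles X m) {k : SimplexCategoryᵒᵖ} (θ : op (SimplexCategory.mk m) ⟶ k)
    (h : k.unop.len < m) : (X.map θ).hom x = 1 := by
  induction k using Opposite.rec with | op k => ?_
  induction k using SimplexCategory.rec with | _ k => ?_
  obtain ⟨m, rfl⟩ : ∃ l, m = l + 1 := ⟨m - 1, by simp at h; omega⟩
  obtain ⟨i, hi⟩ : ∃ i, ∀ t, SimplexCategory.Hom.toOrderHom θ.unop t ≠ i := by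
    by_contra! hcon
    have := Fintype.card_le_of_surjective _ hcon
    simp at this h
    omega
  obtain ⟨θ', hθ'⟩ := exists_map_eq_map_face X _ θ hi
  rw [hθ', face_eq_one_of_mem_cycles hx i, map_one]

theorem boundaries_le_cycles (X : SGrp.{u}) (m : ℕ) : boundaries X m ≤ cycles X m := by
  rintro _ ⟨x, hx, rfl⟩
  cases m with
  | zero => trivial
  | succ m =>
    -- The composite of two faces drops the degree by two, hence vanishes on the Moore complex.
    have key : ∀ i, face X i (face X (Fin.last (m + 2)) x) = 1 := fun i => by
      refine Eq.trans ?_ (map_eq_one_of_mem_moore hx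
        ((SimplexCategory.δ (Fin.last (m + 2))).op ≫ (SimplexCategory.δ i).op) (Nat.lt_succ_self m))
      rw [X.map_comp]
      rfl
    exact ⟨mem_moore_succ.2 fun i => key _, key _⟩

/-! ### Lifting to the Moore complex -/

/-- On vertices, the composite of the j-th codegeneracy and the j-th coface sends j to j + 1 and
fixes every other vertex. Preceded by the i-th coface it still misses i, because i < j; so the whole
operator factors through `d_i`. -/
theorem face_degen_face_eq_one {X : SGrp.{u}} {m : ℕ} {x : grp X (m + 1)} {i j : Fin (m + 1)}
    (hij : i < j) (hi : face X i.castSucc x = 1) :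
    face X i.castSucc (degen X j (face X j.castSucc x)) = 1 := by
  obtain ⟨θ', hθ'⟩ := exists_map_eq_map_face X i.castSucc
    (((SimplexCategory.δ j.castSucc).op ≫ (SimplexCategory.σ j).op) ≫
      (SimplexCategory.δ i.castSucc).op) (by
    intro t
    change j.castSucc.succAbove (j.predAbove (i.castSucc.succAbove t)) ≠ i.castSucc
    have hy : i.castSucc.succAbove t ≠ i.castSucc := Fin.succAbove_ne _ _
    generalize i.castSucc.succAbove t = y at hy
    rcases le_or_gt y j.castSucc with hle | hgt
    · rw [Fin.predAbove_of_le_castSucc _ _ hle]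
      rw [Ne, Fin.ext_iff] at hy ⊢
      simp only [Fin.succAbove, Fin.lt_def, Fin.le_def] at hle hij ⊢
      split_ifs <;> simp_all <;> omega
    · rw [Fin.predAbove_of_castSucc_lt _ _ hgt, Ne, Fin.ext_iff]
      simp only [Fin.succAbove, Fin.lt_def] at hgt hij ⊢
      split_ifs <;> (simp_all; omega))
  have h1 := hθ' x
  rw [hi, map_one, X.map_comp, X.map_comp] at h1
  exact h1

/-- An element whose lower faces lie in a simplicial family of subgroups can be corrected by an
element of that family to an element of the Moore complex. -/
theorem exists_mul_mem_moore {X : SGrp.{u}} {m : ℕ} (R : Subgroup (grp X m))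
    (S : Subgroup (grp X (m + 1))) (hs : ∀ (i : Fin (m + 1)), ∀ x ∈ R, degen X i x ∈ S)
    (hd : ∀ (i : Fin (m + 2)), ∀ x ∈ S, face X i x ∈ R) (x : grp X (m + 1))
    (hx : ∀ i : Fin (m + 1), face X i.castSucc x ∈ R) : ∃ r ∈ S, x * r ∈ moore X (m + 1) := by
  -- The faces are made trivial one at a time, in increasing order.
  suffices H : ∀ j : ℕ, j ≤ m + 1 →
      ∃ r ∈ S, ∀ i : Fin (m + 1), (i : ℕ) < j → face X i.castSucc (x * r) = 1 by
    obtain ⟨r, hr, h⟩ := H (m + 1) le_rfl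
    exact ⟨r, hr, mem_moore_succ.2 fun i => h i i.2⟩
  intro j
  induction j with
  | zero => exact fun _ => ⟨1, one_mem _, fun i hi => absurd hi (Nat.not_lt_zero _)⟩
  | succ j ih =>
    intro hj
    obtain ⟨r, hr, h⟩ := ih (by omega)
    let j' : Fin (m + 1) := ⟨j, by omega⟩
    -- Dividing y = x r by s_j d_j y kills the j-th face, and by `face_degen_face_eq_one` leaves the
    -- earlier faces trivial.
    refine ⟨r * (degen X j' (face X j'.castSucc (x * r)))⁻¹, S.mul_mem hr (S.inv_mem (hs _ _ ?_)),
      fun i hi => ?_⟩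
    · rw [map_mul]
      exact R.mul_mem (hx j') (hd _ _ hr)
    · rw [← mul_assoc, map_mul, map_inv]
      rcases Nat.lt_succ_iff_lt_or_eq.1 hi with hlt | heq
      · rw [h i hlt, face_degen_face_eq_one (i := i) (j := j') hlt (h i hlt), inv_one, one_mul]
      · obtain rfl : i = j' := Fin.ext heq
        rw [face_degen_castSucc, mul_inv_cancel]

theorem NormalSub.exists_mul_mem_moore {X : SGrp.{u}} (R : NormalSub X) {m : ℕ}
    (x : grp X (m + 1)) (hx : ∀ i : Fin (m + 1), face X i.castSucc x ∈ R.sub _) :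
    ∃ r ∈ R.sub (op (SimplexCategory.mk (m + 1))), x * r ∈ moore X (m + 1) :=
  SimpGrp.exists_mul_mem_moore (R.sub _) (R.sub _) (fun _ _ h => R.map_mem _ h)
    (fun _ _ h => R.map_mem _ h) x hx

/-- The Moore complex of a quotient is the image of the Moore complex. -/
theorem exists_mem_moore_of_mem_moore_quotient {X : SGrp.{u}} (R : NormalSub X) {m : ℕ}
    {q : grp R.quotient m} (hq : q ∈ moore R.quotient m) :
    ∃ x ∈ moore X m, (QuotientGroup.mk x : X.obj _ ⧸ R.sub _) = q := by
  induction q using QuotientGroup.induction_on with | H x => ?_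
  cases m with
  | zero => exact ⟨x, trivial, rfl⟩
  | succ m =>
    obtain ⟨r, hr, h⟩ := R.exists_mul_mem_moore x (mk_mem_moore_succ.1 hq)
    exact ⟨_, h, QuotientGroup.mk_mul_of_mem x hr⟩

theorem mk_mem_moore {X : SGrp.{u}} (R : NormalSub X) {m : ℕ} {x : grp X m} (hx : x ∈ moore X m) :
    (QuotientGroup.mk x : X.obj _ ⧸ R.sub _) ∈ moore R.quotient m := by
  cases m with
  | zero => trivial
  | succ m =>
    refine mk_mem_moore_succ.2 fun i => ?_
    rw [mem_moore_succ.1 hx i]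
    exact one_mem _

/-! ### The radicals in low degrees -/

/-- The simplices all of whose `n`-dimensional faces are boundaries. -/
def boundarySub (n : ℕ) (X : SGrp.{u}) : NormalSub X where
  sub m := ⨅ θ : m ⟶ op (SimplexCategory.mk n), (boundaries X n).comap (X.map θ).hom
  normal m := Subgroup.normal_iInf_normal fun θ => inferInstance
  map_mem f x hx := by
    simp only [Subgroup.mem_iInf, Subgroup.mem_comap] at hx ⊢
    intro θ
    have := hx (f ≫ θ)
    rw [X.map_comp] at this
    exact this

theorem mem_boundarySub {n : ℕ} {X : SGrp.{u}} {m : SimplexCategoryᵒᵖ} {x : X.obj m} :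
    x ∈ (boundarySub n X).sub m ↔
      ∀ θ : m ⟶ op (SimplexCategory.mk n), (X.map θ).hom x ∈ boundaries X n := by
  simp [boundarySub, Subgroup.mem_iInf]

theorem boundarySub_le (n : ℕ) (X : SGrp.{u}) :
    (boundarySub n X).sub (op (SimplexCategory.mk n)) ≤ boundaries X n := fun x hx => by
  have := mem_boundarySub.1 hx (𝟙 _)
  rw [X.map_id] at this
  exact this

/-- By minimality of `cotSub`, this bounds `μ_{n ≥}` by the boundaries in degree n. An n-dimensional
face of x either factors through a lower face of x, where the hypothesis applies, or is the last
face of an (n+1)-simplex. In the latter case x is a Moore element up to a factor in `boundarySub`.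
-/
theorem mooreTrivialAbove_quotient_boundarySub (n : ℕ) (X : SGrp.{u}) :
    MooreTrivialAbove n (boundarySub n X).quotient := by
  refine mooreTrivialAbove_quotient_iff.2 fun m hm x hx => mem_boundarySub.2 fun θ => ?_
  by_cases h : ∃ i : Fin (m + 1), ∀ t, SimplexCategory.Hom.toOrderHom θ.unop t ≠ i.castSucc
  · obtain ⟨i, hi⟩ := h
    obtain ⟨θ', hθ'⟩ := exists_map_eq_map_face X _ θ hi
    rw [hθ']
    exact mem_boundarySub.1 (hx i) θ'
  · obtain rfl : m = n := by
      by_contra hne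
      exact h (exists_castSucc_not_mem_range (by omega) θ.unop)
    have hθ : θ = (SimplexCategory.δ (Fin.last (m + 1))).op :=
      Quiver.Hom.unop_inj ((eq_δ_last_or_exists_castSucc θ.unop).resolve_right h)
    obtain ⟨r, hr, hxr⟩ := (boundarySub m X).exists_mul_mem_moore x hx
    have h1 : (X.map θ).hom (x * r) ∈ boundaries X m := by
      rw [hθ]
      exact ⟨_, hxr, rfl⟩
    rw [map_mul] at h1
    exact (Subgroup.mul_mem_cancel_right _ (mem_boundarySub.1 hr θ)).1 h1

theorem muLE_le_boundaries (n : ℕ) (X : SGrp.{u}) :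
    (muLE n X).sub (op (SimplexCategory.mk n)) ≤ boundaries X n := by
  rw [muLE_eq]
  exact (cotSub_le (mooreTrivialAbove_quotient_boundarySub n X) _).trans (boundarySub_le n X)

theorem moore_le_muLE {n m : ℕ} (h : n < m) (X : SGrp.{u}) :
    moore X m ≤ (muLE n X).sub (op (SimplexCategory.mk m)) := by
  obtain ⟨m, rfl⟩ : ∃ l, m = l + 1 := ⟨m - 1, by omega⟩
  rw [muLE_eq]
  refine fun x hx => mooreTrivialAbove_quotient_iff.1 (cot_mem n X) m (by omega) x fun i => ?_
  rw [mem_moore_succ.1 hx i]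
  exact one_mem _

theorem muGE_eq_one {n m : ℕ} (h : m < n) {X : SGrp.{u}} {x : grp X m}
    (hx : x ∈ (muGE n X).sub _) : x = 1 := by
  have := mem_muGE.1 hx m h (𝟙 _)
  rw [X.map_id] at this
  exact this

theorem muLE_eq_one {n m : ℕ} (h : m < n) {X : SGrp.{u}} {x : grp X m}
    (hx : x ∈ (muLE n X).sub _) : x = 1 :=
  muGE_eq_one h (muLE_le_muGE n X _ hx)

theorem cycles_le_muGE (n : ℕ) (X : SGrp.{u}) :
    cycles X n ≤ (muGE n X).sub (op (SimplexCategory.mk n)) :=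
  fun _ hx => mem_muGE.2 fun _ hk θ => map_eq_one_of_mem_cycles hx θ hk

/-! ### Homotopy groups of subquotients -/

theorem subsingleton_homotopyGroup {Y : SGrp.{u}} {m : ℕ} (h : cycles Y m ≤ boundaries Y m) :
    Subsingleton (homotopyGroup Y m) :=
  QuotientGroup.subsingleton_iff.2 (Subgroup.subgroupOf_eq_top.2 h)

theorem mem_moore_toSGrp {X : SGrp.{u}} (σ : NormalSub X) {m : ℕ} {x : grp σ.toSGrp m} :
    x ∈ moore σ.toSGrp m ↔ x.1 ∈ moore X m := by
  cases m with
  | zero => exact ⟨fun _ => trivial, fun _ => trivial⟩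
  | succ m =>
    refine mem_moore_succ.trans (Iff.trans ?_ mem_moore_succ.symm)
    exact forall_congr' fun i => Subtype.ext_iff

section Subquotient

variable {X : SGrp.{u}} {σ τ : NormalSub X} (h : τ ≤ σ)

/-- The class in `σ / τ` of a simplex of `σ`. -/
def NormalSub.mkSub {m : ℕ} (h : τ ≤ σ) :
    σ.sub (op (SimplexCategory.mk m)) →* grp (σ.subquotient τ h) m :=
  ((restrict τ σ h).π.app (op (SimplexCategory.mk m))).hom

theorem NormalSub.mkSub_surjective {m : ℕ} : Function.Surjective (mkSub (m := m) h) :=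
  QuotientGroup.mk_surjective

theorem NormalSub.mkSub_eq_one {m : ℕ} {x : σ.sub (op (SimplexCategory.mk m))} :
    mkSub h x = 1 ↔ x.1 ∈ τ.sub (op (SimplexCategory.mk m)) :=
  QuotientGroup.eq_one_iff _

theorem NormalSub.mkSub_eq {m : ℕ} {x y : σ.sub (op (SimplexCategory.mk m))} :
    mkSub h x = mkSub h y ↔ x.1⁻¹ * y.1 ∈ τ.sub (op (SimplexCategory.mk m)) :=
  QuotientGroup.eq

/-- The faces of `σ`, on underlying simplices. -/
def NormalSub.faceSub (σ : NormalSub X) {m : ℕ} (i : Fin (m + 2))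
    (x : σ.sub (op (SimplexCategory.mk (m + 1)))) : σ.sub (op (SimplexCategory.mk m)) :=
  ⟨face X i x.1, σ.map_mem _ x.2⟩

open NormalSub

theorem mem_moore_subquotient {m : ℕ} {q : grp (σ.subquotient τ h) m} :
    q ∈ moore (σ.subquotient τ h) m ↔ ∃ x, x.1 ∈ moore X m ∧ mkSub h x = q := by
  constructor
  · intro hq
    obtain ⟨x, hx, hxq⟩ := exists_mem_moore_of_mem_moore_quotient _ hq
    exact ⟨x, (mem_moore_toSGrp σ).1 hx, hxq⟩
  · rintro ⟨x, hx, rfl⟩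
    exact mk_mem_moore _ ((mem_moore_toSGrp σ).2 hx)

theorem mem_boundaries_subquotient {m : ℕ} {q : grp (σ.subquotient τ h) m} :
    q ∈ boundaries (σ.subquotient τ h) m ↔
      ∃ y : σ.sub (op (SimplexCategory.mk (m + 1))), y.1 ∈ moore X (m + 1) ∧
        mkSub h (σ.faceSub (Fin.last (m + 1)) y) = q := by
  constructor
  · rintro ⟨p, hp, rfl⟩
    obtain ⟨y, hy, rfl⟩ := (mem_moore_subquotient h).1 hp
    exact ⟨y, hy, rfl⟩
  · rintro ⟨y, hy, rfl⟩
    exact ⟨mkSub h y, (mem_moore_subquotient h).2 ⟨y, hy, rfl⟩, rfl⟩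

theorem mem_cycles_subquotient {m : ℕ} {q : grp (σ.subquotient τ h) (m + 1)} :
    q ∈ cycles (σ.subquotient τ h) (m + 1) ↔
      ∃ x : σ.sub (op (SimplexCategory.mk (m + 1))), x.1 ∈ moore X (m + 1) ∧
        face X (Fin.last (m + 1)) x.1 ∈ τ.sub (op (SimplexCategory.mk m)) ∧ mkSub h x = q := by
  constructor
  · rintro ⟨hq, hf⟩
    obtain ⟨x, hx, rfl⟩ := (mem_moore_subquotient h).1 hq
    exact ⟨x, hx, (mkSub_eq_one h).1 hf, rfl⟩
  · rintro ⟨x, hx, hf, rfl⟩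
    exact ⟨(mem_moore_subquotient h).2 ⟨x, hx, rfl⟩, (mkSub_eq_one h).2 hf⟩

/-- Used in degrees at most n, where every simplex of `σ` is already the last face of a Moore
element of `σ`. -/
theorem subsingleton_homotopyGroup_of_boundary {m : ℕ}
    (hb : ∀ x ∈ σ.sub (op (SimplexCategory.mk m)), ∃ y ∈ moore X (m + 1),
      y ∈ σ.sub (op (SimplexCategory.mk (m + 1))) ∧ face X (Fin.last (m + 1)) y = x) :
    Subsingleton (homotopyGroup (σ.subquotient τ h) m) := by
  refine subsingleton_homotopyGroup fun q _ => ?_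
  obtain ⟨x, rfl⟩ := mkSub_surjective h q
  obtain ⟨y, hy, hyσ, hyx⟩ := hb x.1 x.2
  exact (mem_boundaries_subquotient h).2 ⟨⟨y, hyσ⟩, hy, congrArg _ (Subtype.ext hyx)⟩

/-- Cycles of `σ / τ` lift to Moore elements whose last face lies in `τ`. If these all lie in `τ`,
the quotient has no nontrivial cycles. -/
theorem subsingleton_homotopyGroup_of_cycle {m : ℕ}
    (hc : ∀ x ∈ moore X (m + 1), face X (Fin.last (m + 1)) x ∈ τ.sub (op (SimplexCategory.mk m)) →
      x ∈ τ.sub (op (SimplexCategory.mk (m + 1)))) :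
    Subsingleton (homotopyGroup (σ.subquotient τ h) (m + 1)) := by
  refine subsingleton_homotopyGroup fun q hq => ?_
  obtain ⟨x, hx, hf, rfl⟩ := (mem_cycles_subquotient h).1 hq
  rw [(mkSub_eq_one h).2 (hc _ hx hf)]
  exact one_mem _

/-- If `σ` contains the cycles of degree `m + 1` and the Moore complex in degree `m + 2`, and `τ`
is trivial in degree `m` and consists of boundaries in degree `m + 1`, then the quotient `σ / τ`
has the same homotopy group as `X` in degree `m + 1`. -/
theorem nonempty_homotopyGroup_subquotient {m : ℕ}
    (hσ : cycles X (m + 1) ≤ σ.sub (op (SimplexCategory.mk (m + 1))))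
    (hσ' : moore X (m + 2) ≤ σ.sub (op (SimplexCategory.mk (m + 2))))
    (hτ : τ.sub (op (SimplexCategory.mk m)) = ⊥)
    (hτ' : τ.sub (op (SimplexCategory.mk (m + 1))) ≤ boundaries X (m + 1)) :
    Nonempty (homotopyGroup (σ.subquotient τ h) (m + 1) ≃* homotopyGroup X (m + 1)) := by
  let g : cycles X (m + 1) →* cycles (σ.subquotient τ h) (m + 1) :=
    ((mkSub h).comp (Subgroup.inclusion hσ)).codRestrict _ fun x =>
      (mem_cycles_subquotient h).2 ⟨Subgroup.inclusion hσ x, x.2.1, by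
        have : face X (Fin.last (m + 1)) x.1 = 1 := x.2.2
        exact this ▸ one_mem _, rfl⟩
  have hg : ((boundaries (σ.subquotient τ h) (m + 1)).subgroupOf _).comap g =
      (boundaries X (m + 1)).subgroupOf (cycles X (m + 1)) := by
    ext x
    simp only [Subgroup.mem_comap, Subgroup.mem_subgroupOf]
    refine (mem_boundaries_subquotient h).trans ⟨?_, ?_⟩
    · rintro ⟨y, hy, hyx⟩
      -- The cycle x equals the last face of y up to an element of `τ`, itself a boundary.
      have h1 := hτ' ((mkSub_eq h).1 hyx)
      refine (Subgroup.mul_mem_cancel_left _ (inv_mem ?_)).1 h1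
      exact ⟨y.1, hy, rfl⟩
    · rintro ⟨y, hy, hyx⟩
      exact ⟨⟨y, hσ' hy⟩, hy, congrArg (mkSub h) (Subtype.ext hyx)⟩
  have hsurj : Function.Surjective g := by
    rintro ⟨q, hq⟩
    obtain ⟨x, hx, hf, rfl⟩ := (mem_cycles_subquotient h).1 hq
    -- Since `τ` is trivial in degree m, a relative cycle is a genuine cycle of X.
    rw [hτ, Subgroup.mem_bot] at hf
    exact ⟨⟨x.1, hx, hf⟩, rfl⟩
  let G := (QuotientGroup.mk' ((boundaries (σ.subquotient τ h) (m + 1)).subgroupOf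
    (cycles (σ.subquotient τ h) (m + 1)))).comp g
  have hker : G.ker = (boundaries X (m + 1)).subgroupOf (cycles X (m + 1)) := by
    rw [← MonoidHom.comap_ker, QuotientGroup.ker_mk', hg]
  have hG : Function.Surjective G := (QuotientGroup.mk'_surjective _).comp hsurj
  exact ⟨((QuotientGroup.quotientMulEquivOfEq hker).symm.trans
    (QuotientGroup.quotientKerEquivOfSurjective G hG)).symm⟩

/-- A quotient `σ / τ` of normal simplicial subgroups with `μ_{≥ n+1} ≤ σ ≤ μ_{n ≥}` and
`τ ≤ μ_{n+1 ≥}` has the homotopy groups of an Eilenberg–Mac Lane simplicial group, if `σ` is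
acyclic in degree `n` and `τ` contains the relative cycles above degree `n + 1`. -/
theorem isEilenbergMacLane_subquotient (n : ℕ) (h1 : muGE (n + 1) X ≤ σ) (h2 : σ ≤ muLE n X)
    (h3 : ∀ x ∈ σ.sub (op (SimplexCategory.mk n)), ∃ y ∈ moore X (n + 1),
      y ∈ σ.sub (op (SimplexCategory.mk (n + 1))) ∧ face X (Fin.last (n + 1)) y = x)
    (h4 : τ ≤ muLE (n + 1) X)
    (h5 : ∀ m, n + 1 ≤ m → ∀ x ∈ moore X (m + 1),
      face X (Fin.last (m + 1)) x ∈ τ.sub (op (SimplexCategory.mk m)) →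
        x ∈ τ.sub (op (SimplexCategory.mk (m + 1)))) :
    IsEilenbergMacLane (homotopyGroup X (n + 1)) (n + 1) (σ.subquotient τ h) := by
  refine ⟨nonempty_homotopyGroup_subquotient h ((cycles_le_muGE _ X).trans (h1 _))
    ((moore_le_muLE (Nat.lt_succ_self _) X).trans ((muLE_le_muGE _ X _).trans (h1 _)))
    ((Subgroup.eq_bot_iff_forall _).2 fun x hx => muLE_eq_one (Nat.lt_succ_self n) (h4 _ hx))
    ((h4 _).trans (muLE_le_boundaries _ X)), fun i hi => ?_⟩
  -- Below n the group `σ` is trivial, and degree n is `h3`. In the remaining case `hi` excludes i =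
  -- n + 1, so i is at least n + 2 and `h5` applies to its predecessor.
  rcases lt_trichotomy i n with hlt | rfl | hgt
  · refine subsingleton_homotopyGroup_of_boundary h fun x hx => ⟨1, one_mem _, one_mem _, ?_⟩
    rw [muLE_eq_one hlt (h2 _ hx), map_one]
  · exact subsingleton_homotopyGroup_of_boundary h h3
  · obtain ⟨m, rfl⟩ : ∃ l, i = l + 1 := ⟨i - 1, by omega⟩
    exact subsingleton_homotopyGroup_of_cycle h (h5 m (by omega))

end Subquotient

/-! ### The radicals satisfy the hypotheses of the subquotient criterion -/

section Radicals

variable (n : ℕ) (X : SGrp.{u})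

theorem exists_face_eq_of_mem_muLE (x : grp X n)
    (hx : x ∈ (muLE n X).sub (op (SimplexCategory.mk n))) :
    ∃ y ∈ moore X (n + 1), y ∈ (muLE n X).sub (op (SimplexCategory.mk (n + 1))) ∧
      face X (Fin.last (n + 1)) y = x := by
  obtain ⟨y, hy, hyx⟩ := muLE_le_boundaries n X hx
  exact ⟨y, hy, moore_le_muLE (Nat.lt_succ_self n) X hy, hyx⟩

theorem exists_face_eq_of_mem_muGE (x : grp X n)
    (hx : x ∈ (muGE (n + 1) X).sub (op (SimplexCategory.mk n))) :
    ∃ y ∈ moore X (n + 1), y ∈ (muGE (n + 1) X).sub (op (SimplexCategory.mk (n + 1))) ∧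
      face X (Fin.last (n + 1)) y = x :=
  ⟨1, one_mem _, one_mem _, by rw [muGE_eq_one (Nat.lt_succ_self n) hx, map_one]⟩

/-- In degree n + 1 the last face is trivial, so x is a cycle; in higher degrees the radical
contains the whole Moore complex. -/
theorem mem_muGE_of_face_mem (m : ℕ) (hm : n ≤ m) (x : grp X (m + 1)) (hx : x ∈ moore X (m + 1))
    (hf : face X (Fin.last (m + 1)) x ∈ (muGE (n + 1) X).sub (op (SimplexCategory.mk m))) :
    x ∈ (muGE (n + 1) X).sub (op (SimplexCategory.mk (m + 1))) := by
  rcases hm.eq_or_lt with rfl | hlt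
  · exact cycles_le_muGE _ X ⟨hx, muGE_eq_one (Nat.lt_succ_self n) hf⟩
  · exact muLE_le_muGE _ X _ (moore_le_muLE (Nat.succ_lt_succ hlt) X hx)

end Radicals

/-! ### Isomorphisms of simplicial groups with bounded Moore complex -/

theorem hom_face {Y W : SGrp.{u}} (f : Y ⟶ W) {m : ℕ} (i : Fin (m + 2)) (x : grp Y (m + 1)) :
    (f.app (op (SimplexCategory.mk m))).hom (face Y i x) =
      face W i ((f.app (op (SimplexCategory.mk (m + 1)))).hom x) :=
  ConcreteCategory.congr_hom (f.naturality (SimplexCategory.δ i).op) x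

theorem hom_degen {Y W : SGrp.{u}} (f : Y ⟶ W) {m : ℕ} (i : Fin (m + 1)) (x : grp Y m) :
    (f.app (op (SimplexCategory.mk (m + 1)))).hom (degen Y i x) =
      degen W i ((f.app (op (SimplexCategory.mk m))).hom x) :=
  ConcreteCategory.congr_hom (f.naturality (SimplexCategory.σ i).op) x

/-- A morphism of simplicial groups is bijective in degree `m + 1` if it is so in degree `m` and the
Moore complexes are trivial in degree `m + 1`. -/
theorem bijective_succ {Y W : SGrp.{u}} (f : Y ⟶ W) {m : ℕ} (hY : moore Y (m + 1) = ⊥)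
    (hW : moore W (m + 1) = ⊥) (h : Function.Bijective (f.app (op (SimplexCategory.mk m))).hom) :
    Function.Bijective (f.app (op (SimplexCategory.mk (m + 1)))).hom := by
  constructor
  · refine (injective_iff_map_eq_one _).2 fun x hx => ?_
    rw [← Subgroup.mem_bot, ← hY]
    refine mem_moore_succ.2 fun i => h.1 ?_
    rw [hom_face, hx, map_one, map_one]
  · intro y
    -- The image of f contains all degeneracies, since f is onto in degree m. So y can be corrected
    -- within the image to a Moore element, which is trivial.
    obtain ⟨_, ⟨x, rfl⟩, hr⟩ := SimpGrp.exists_mul_mem_moore (X := W) (m := m) ⊤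
      (f.app (op (SimplexCategory.mk (m + 1)))).hom.range
      (fun i w _ => by
        obtain ⟨x, rfl⟩ := h.2 w
        exact ⟨degen Y i x, hom_degen f i x⟩) (fun _ _ _ => trivial) y fun _ => trivial
    rw [hW, Subgroup.mem_bot] at hr
    exact ⟨x⁻¹, by rw [map_inv]; exact (eq_inv_of_mul_eq_one_left hr).symm⟩

theorem isIso_of_bijective {Y W : SGrp.{u}} (f : Y ⟶ W) {N : ℕ} (hY : MooreTrivialAbove N Y)
    (hW : MooreTrivialAbove N W)
    (h : ∀ m ≤ N, Function.Bijective (f.app (op (SimplexCategory.mk m))).hom) : IsIso f := by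
  have key : ∀ m : ℕ, Function.Bijective (f.app (op (SimplexCategory.mk m))).hom := by
    intro m
    induction m with
    | zero => exact h 0 (Nat.zero_le N)
    | succ m ih =>
      by_cases hm : m + 1 ≤ N
      · exact h _ hm
      · exact bijective_succ f (hY _ (by omega)) (hW _ (by omega)) ih
  have : ∀ m, IsIso (f.app m) := fun m => by
    induction m using Opposite.rec with | op m => ?_
    induction m using SimplexCategory.rec with | _ m => ?_
    exact (ConcreteCategory.isIso_iff_bijective _).2 (key m)
  exact NatIso.isIso_of_isIso_app f

/-! ### Coskeleta -/

/-- A simplicial group embedded in its `N`-coskeleton, with Moore complex trivial in degree `N`, has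
Moore complex trivial above degree `N`. -/
theorem moore_eq_bot_of_muGE {W : SGrp.{u}} {N : ℕ}
    (hW : ∀ (m : ℕ) (x : grp W m), x ∈ (muGE (N + 1) W).sub _ → x = 1) (hN : moore W N = ⊥) :
    MooreTrivialAbove N W := by
  intro i hi
  refine (Subgroup.eq_bot_iff_forall _).2 fun x hx => hW _ _ ?_
  obtain ⟨i, rfl⟩ : ∃ l, i = l + 1 := ⟨i - 1, by omega⟩
  refine mem_muGE_of_face_mem N W i (by omega) x hx ?_
  -- In degree N + 1 the last face lies in the trivial group M_N. In higher degrees, any operator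
  -- from that face to degree at most N drops the degree of x by at least two.
  rcases (Nat.le_of_lt_succ hi).eq_or_lt with rfl | hlt
  · have h1 : face W (Fin.last (N + 1)) x ∈ moore W N := by
      have h2 := boundaries_le_cycles W N ⟨x, hx, rfl⟩
      cases N with
      | zero => trivial
      | succ N => exact h2.1
    rw [hN, Subgroup.mem_bot] at h1
    rw [h1]
    exact one_mem _
  · refine mem_muGE.2 fun k hk θ => ?_
    have := map_eq_one_of_mem_moore hx ((SimplexCategory.δ (Fin.last (i + 1))).op ≫ θ)
      (show k < i by omega)
    rw [W.map_comp] at this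
    exact this

/-- By the right triangle identity the unit at a coskeleton has a retraction, so its kernel is
trivial. -/
theorem eq_one_of_mem_muGE_cosk {N : ℕ} (T : SimplicialObject.Truncated GrpCat.{u} N) (m : ℕ)
    (x : grp ((SimplicialObject.Truncated.cosk N).obj T) m)
    (hx : x ∈ (muGE (N + 1) ((SimplicialObject.Truncated.cosk N).obj T)).sub _) : x = 1 := by
  have h1 := congrArg (fun φ => φ.app (op (SimplexCategory.mk m)))
    ((SimplicialObject.coskAdj (C := GrpCat.{u}) N).right_triangle_components T)
  have h2 := ConcreteCategory.congr_hom h1 x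
  refine h2.symm.trans ?_
  exact (congrArg (((SimplicialObject.Truncated.cosk N).map
      ((SimplicialObject.coskAdj (C := GrpCat.{u}) N).counit.app T)).app _).hom hx).trans
    (map_one _)

/-- The counit is an isomorphism, so by the left triangle identity the truncated unit is one too. -/
theorem bijective_coskUnit {N : ℕ} (Y : SGrp.{u}) {m : ℕ} (hm : m ≤ N) :
    Function.Bijective ((coskUnit N Y).app (op (SimplexCategory.mk m))).hom := by
  have h1 := (SimplicialObject.coskAdj (C := GrpCat.{u}) N).left_triangle_components Y
  have h2 : IsIso ((SimplicialObject.truncation N).map (coskUnit N Y)) := by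
    have h3 : IsIso ((SimplicialObject.truncation N).map (coskUnit N Y) ≫
        (SimplicialObject.coskAdj (C := GrpCat.{u}) N).counit.app
          ((SimplicialObject.truncation N).obj Y)) := by
      rw [coskUnit, h1]
      infer_instance
    exact IsIso.of_isIso_comp_right _ ((SimplicialObject.coskAdj (C := GrpCat.{u}) N).counit.app
          ((SimplicialObject.truncation N).obj Y))
  have h4 : IsIso (((SimplicialObject.truncation N).map (coskUnit N Y)).app
    (op ⟨SimplexCategory.mk m, hm⟩)) := inferInstance
  exact (ConcreteCategory.isIso_iff_bijective _).1 h4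

/-- The coskeleton is taken one degree above the Moore bound: M_{N+1} of the coskeleton vanishes
because it is computed in Y, and `moore_eq_bot_of_muGE` then bounds the higher degrees. -/
theorem isIso_coskUnit {N : ℕ} {Y : SGrp.{u}} (hY : MooreTrivialAbove N Y) :
    IsIso (coskUnit (N + 1) Y) := by
  have hb := fun m hm => bijective_coskUnit (N := N + 1) Y (m := m) hm
  refine isIso_of_bijective _ (N := N + 1) (fun i hi => hY i (by omega)) ?_ hb
  refine moore_eq_bot_of_muGE (eq_one_of_mem_muGE_cosk _)
    ((Subgroup.eq_bot_iff_forall _).2 fun y hy => ?_)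
  obtain ⟨x, rfl⟩ := (hb _ le_rfl).2 y
  have hx : x ∈ moore Y (N + 1) := mem_moore_succ.2 fun i =>
    (hb N (Nat.le_succ N)).1 <| by
      rw [hom_face, map_one]
      exact mem_moore_succ.1 hy i
  rw [hY _ (Nat.lt_succ_self N), Subgroup.mem_bot] at hx
  rw [hx, map_one]

/-! ### The Eilenberg–Mac Lane simplicial group in all degrees -/

/-- A value skipped between adjacent vertices could not be attained elsewhere, by monotonicity. -/
theorem Surj.apply_le_add_one {m p : ℕ} (σ : Surj (SimplexCategory.mk m) p) {a b : Fin (m + 1)}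
    (hab : (b : ℕ) = a + 1) :
    (SimplexCategory.Hom.toOrderHom σ.1 b : Fin (p + 1)).1 ≤
      (SimplexCategory.Hom.toOrderHom σ.1 a : Fin (p + 1)).1 + 1 := by
  by_contra! hlt
  obtain ⟨t, ht⟩ := σ.2 ⟨(SimplexCategory.Hom.toOrderHom σ.1 a : Fin (p + 1)).1 + 1,
    hlt.trans (SimplexCategory.Hom.toOrderHom σ.1 b : Fin (p + 1)).2⟩
  rw [Fin.ext_iff] at ht
  change (SimplexCategory.Hom.toOrderHom σ.1 t : Fin (p + 1)).1 = _ at ht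
  rcases le_or_gt t a with h | h
  · have : (SimplexCategory.Hom.toOrderHom σ.1 t : Fin (p + 1)).1 ≤
      (SimplexCategory.Hom.toOrderHom σ.1 a : Fin (p + 1)).1 :=
      (SimplexCategory.Hom.toOrderHom σ.1).monotone h
    simp only at ht
    omega
  · have : (SimplexCategory.Hom.toOrderHom σ.1 b : Fin (p + 1)).1 ≤
      (SimplexCategory.Hom.toOrderHom σ.1 t : Fin (p + 1)).1 :=
      (SimplexCategory.Hom.toOrderHom σ.1).monotone
        (Fin.le_def.2 (by have := Fin.lt_def.1 h; omega))
    simp only at ht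
    omega

theorem Surj.apply_zero {m p : ℕ} (σ : Surj (SimplexCategory.mk m) p) :
    SimplexCategory.Hom.toOrderHom σ.1 (0 : Fin (m + 1)) = (0 : Fin (p + 1)) := by
  obtain ⟨t, ht⟩ := σ.2 (0 : Fin (p + 1))
  refine le_antisymm ?_ (Fin.zero_le _)
  rw [← ht]
  exact (SimplexCategory.Hom.toOrderHom σ.1).monotone (show (0 : Fin (m + 1)) ≤ t from Fin.zero_le _)

theorem Surj.ext_apply {m p : ℕ} {σ σ' : Surj (SimplexCategory.mk m) p}
    (h : ∀ t, SimplexCategory.Hom.toOrderHom σ.1 t = SimplexCategory.Hom.toOrderHom σ'.1 t) :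
    σ = σ' :=
  Subtype.ext (SimplexCategory.Hom.ext _ _ (OrderHom.ext _ _ (funext h)))

/-- A function on surjections `[m+1] → [p]` whose lower faces are trivial vanishes on the
surjections that identify `j` and `j + 1`. -/
theorem eq_one_of_surjMap_eq_one (A : Type u) [CommGroup A] {m p : ℕ}
    {f : Surj (SimplexCategory.mk (m + 1)) p → A}
    (hf : ∀ i : Fin (m + 1), surjMap A p (SimplexCategory.δ i.castSucc) f = 1) (j : ℕ) :
    ∀ (hj : j < m + 1) (σ : Surj (SimplexCategory.mk (m + 1)) p),
      SimplexCategory.Hom.toOrderHom σ.1 (Fin.castSucc ⟨j, hj⟩) =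
        SimplexCategory.Hom.toOrderHom σ.1 (Fin.succ ⟨j, hj⟩) → f σ = 1 := by
  induction j with
  | zero => ?_
  | succ j ih => ?_
  all_goals
    intro hj σ hσ
    obtain ⟨i, hi⟩ : ∃ i : Fin (m + 1), i = ⟨_, hj⟩ := ⟨_, rfl⟩
    rw [← hi] at hσ
    have hsurj : Function.Surjective
        (SimplexCategory.Hom.toOrderHom (SimplexCategory.δ i.castSucc ≫ σ.1)) := by
      intro y
      obtain ⟨t, ht⟩ := σ.2 y
      by_cases h : t = i.castSucc
      · obtain ⟨s, hs⟩ := Fin.exists_succAbove_eq (x := i.succ) (y := i.castSucc)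
          (Fin.castSucc_lt_succ (i := i)).ne'
        refine ⟨s, Eq.trans ?_ (((congrArg _ h).trans hσ).symm.trans ht)⟩
        exact congrArg (SimplexCategory.Hom.toOrderHom σ.1) hs
      · obtain ⟨s, hs⟩ := Fin.exists_succAbove_eq h
        exact ⟨s, (congrArg (SimplexCategory.Hom.toOrderHom σ.1) hs).trans ht⟩
    have h1 := congrFun (hf i) ⟨_, hsurj⟩
    change (∏ σ' : Surj (SimplexCategory.mk (m + 1)) p, if SimplexCategory.δ i.castSucc ≫ σ'.1 =
      SimplexCategory.δ i.castSucc ≫ σ.1 then f σ' else 1) = 1 at h1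
    -- The j-th face of f at the restriction of σ is the product of f over all σ' agreeing with σ
    -- away from the vertex j. The factors with σ' ≠ σ have to be shown trivial.
    rw [Fintype.prod_eq_single σ, if_pos rfl] at h1
    · exact h1
    intro σ' hne
    refine ite_eq_right_iff.2 fun he => ?_
    have hv : ∀ t, t ≠ i.castSucc →
        SimplexCategory.Hom.toOrderHom σ'.1 t = SimplexCategory.Hom.toOrderHom σ.1 t := by
      intro t ht
      obtain ⟨s, rfl⟩ := Fin.exists_succAbove_eq ht
      exact congrArg (fun φ => SimplexCategory.Hom.toOrderHom φ s) he
    have hi' : SimplexCategory.Hom.toOrderHom σ'.1 i.castSucc ≠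
        SimplexCategory.Hom.toOrderHom σ.1 i.castSucc := fun h => hne <| Surj.ext_apply fun t => by
      by_cases ht : t = i.castSucc
      · rw [ht, h]
      · exact hv t ht
  -- For j = 0 there is no other σ', since both take the value 0 at the first vertex.
  · refine absurd ?_ hi'
    have : i.castSucc = 0 := by rw [hi]; rfl
    rw [this, Surj.apply_zero, Surj.apply_zero]
  -- At the vertex i = j + 1, σ' is strictly below σ, but not below the value at j, where both
  -- agree. As σ jumps by at most one, σ' identifies j and j + 1, and induction applies.
  · refine ih (by omega) σ' ?_
    have e1 : Fin.succ ⟨j, by omega⟩ = i.castSucc := by rw [hi]; rfl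
    have e2 : Fin.castSucc ⟨j, by omega⟩ ≠ i.castSucc := by
      rw [hi, Ne, Fin.ext_iff]; simp
    have h2 := hv _ e2
    have h3 := hv i.succ (Fin.castSucc_lt_succ (i := i)).ne'
    have h4 := (SimplexCategory.Hom.toOrderHom σ'.1).monotone (Fin.castSucc_lt_succ (i := i)).le
    have h5 := (SimplexCategory.Hom.toOrderHom σ'.1).monotone
      (show Fin.castSucc ⟨j, by omega⟩ ≤ i.castSucc by rw [hi, Fin.le_def]; simp)
    have h6 := σ.apply_le_add_one (a := Fin.castSucc ⟨j, by omega⟩) (b := i.castSucc)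
      (by rw [hi]; simp)
    rw [h3, ← hσ] at h4
    rw [e1]
    have h7 := lt_of_le_of_ne h4 hi'
    rw [Fin.lt_def] at h7
    rw [Fin.le_def] at h5
    rw [← h2] at h6
    refine Fin.ext ?_
    change Fin.val (n := p + 1) _ ≤ Fin.val (n := p + 1) _ at h5
    change Fin.val (n := p + 1) _ < Fin.val (n := p + 1) _ at h7
    change Fin.val (n := p + 1) _ = Fin.val (n := p + 1) _
    omega

/-- The Eilenberg–Mac Lane simplicial group, as a power of `A` in each degree. -/
def surjEM (A : Type u) [CommGroup A] (p : ℕ) : SGrp.{u} where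
  obj m := GrpCat.of (Surj m.unop p → A)
  map f := GrpCat.ofHom (surjMap A p f.unop)
  map_id m := congrArg GrpCat.ofHom (surjMap_id A p m.unop)
  map_comp f g := congrArg GrpCat.ofHom (surjMap_comp A p g.unop f.unop)

theorem mooreTrivialAbove_surjEM (A : Type u) [CommGroup A] (p : ℕ) :
    MooreTrivialAbove p (surjEM A p) := by
  intro i hi
  obtain ⟨m, rfl⟩ : ∃ l, i = l + 1 := ⟨i - 1, by omega⟩
  refine (Subgroup.eq_bot_iff_forall _).2 fun f hf => ?_
  refine funext fun (σ : Surj (SimplexCategory.mk (m + 1)) p) => ?_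
  -- As m + 1 > p, the map σ is not injective, and a monotone non-injective map identifies two
  -- adjacent vertices.
  obtain ⟨j, hj⟩ : ∃ j : Fin (m + 1), SimplexCategory.Hom.toOrderHom σ.1 j.castSucc =
      SimplexCategory.Hom.toOrderHom σ.1 j.succ := by
    by_contra! hne
    have hinj : StrictMono (SimplexCategory.Hom.toOrderHom σ.1) :=
      Fin.strictMono_iff_lt_succ.2 fun j =>
        ((SimplexCategory.Hom.toOrderHom σ.1).monotone (Fin.castSucc_lt_succ (i := j)).le).lt_of_ne
          (hne j)
    have := Fintype.card_le_of_injective _ hinj.injective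
    simp at this
    omega
  exact eq_one_of_surjMap_eq_one A (fun i => mem_moore_succ.1 hf i) j.1 j.2 σ hj

/-- The truncation of `surjEM` at p + 1 is `truncEM` by definition, so the isomorphism is the unit
of the coskeleton adjunction. -/
theorem nonempty_surjEM_iso (A : Type u) [CommGroup A] (p : ℕ) :
    Nonempty (surjEM A p ≅ EilenbergMacLane A p) := by
  have := isIso_coskUnit (mooreTrivialAbove_surjEM A p)
  exact ⟨@asIso _ _ _ _ (coskUnit (p + 1) (surjEM A p)) this⟩

/-! ### Recognition of Eilenberg–Mac Lane simplicial groups -/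

/-- Above degree p, the faces of a commutator are commutators, trivial by induction; so the
commutator is a Moore element, hence trivial. This makes the product homomorphism `surjEMHom`
available in every degree. -/
theorem commute_of_moore_concentrated {Q : SGrp.{u}} {p : ℕ}
    (hlow : ∀ m < p, ∀ x : grp Q m, x = 1) (hQ : MooreTrivialAbove p Q)
    (hp : ∀ x y : grp Q p, Commute x y) (m : SimplexCategoryᵒᵖ) (x y : Q.obj m) :
    Commute x y := by
  induction m using Opposite.rec with | op m => ?_
  induction m using SimplexCategory.rec with | _ m => ?_
  induction m with
  | zero =>
    rcases Nat.eq_zero_or_pos p with rfl | h0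
    · exact hp x y
    · rw [hlow 0 h0 x]
      exact Commute.one_left y
  | succ m ih =>
    rcases lt_trichotomy (m + 1) p with hlt | rfl | hgt
    · rw [hlow _ hlt x]
      exact Commute.one_left y
    · exact hp x y
    · rw [← commutatorElement_eq_one_iff_commute, ← Subgroup.mem_bot]
      have h1 := hQ (m + 1) hgt
      change _ ∈ (⊥ : Subgroup (grp Q (m + 1)))
      rw [← h1]
      refine mem_moore_succ.2 fun i => ?_
      rw [map_commutatorElement, commutatorElement_eq_one_iff_commute]
      exact ih _ _

section Recognition

variable {A : Type u} [CommGroup A] {Q : SGrp.{u}} {p : ℕ}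

/-- The homomorphism `∏_σ A → Q_m` that sends the factor indexed by `σ : [m] → [p]` to `Q_m` by
the operator `σ`. -/
def surjEMHom (e : A →* grp Q p) (hc : ∀ m, ∀ x y : Q.obj m, Commute x y)
    (m : SimplexCategoryᵒᵖ) : (Surj m.unop p → A) →* Q.obj m :=
  MonoidHom.noncommPiCoprod (fun σ : Surj m.unop p => (Q.map σ.1.op).hom.comp e)
    fun _ _ _ _ _ => hc m _ _

open Classical in
theorem surjEMHom_mulSingle (e : A →* grp Q p) (hc : ∀ m, ∀ x y : Q.obj m, Commute x y)
    (m : SimplexCategoryᵒᵖ) (σ : Surj m.unop p) (a : A) :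
    surjEMHom e hc m (Pi.mulSingle σ a) = (Q.map σ.1.op).hom (e a) :=
  MonoidHom.noncommPiCoprod_mulSingle _ _ _

open Classical in
theorem surjMap_mulSingle {k m : SimplexCategory} (θ : k ⟶ m) (σ : Surj m p) (a : A) :
    surjMap A p θ (Pi.mulSingle σ a) =
      if h : Function.Surjective (SimplexCategory.Hom.toOrderHom (θ ≫ σ.1)) then
        Pi.mulSingle ⟨θ ≫ σ.1, h⟩ a else 1 := by
  funext τ
  change (∏ σ' : Surj m p, if θ ≫ σ'.1 = τ.1 then Pi.mulSingle (M := fun _ => A) σ a σ' else 1) = _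
  rw [Fintype.prod_eq_single σ fun σ' h => by rw [Pi.mulSingle_eq_of_ne h, ite_self],
    Pi.mulSingle_eq_same]
  split_ifs with h1 h2 h2
  · obtain rfl : τ = ⟨θ ≫ σ.1, h2⟩ := Subtype.ext h1.symm
    rw [Pi.mulSingle_eq_same]
  · exact absurd (h1 ▸ τ.2) h2
  · rw [Pi.mulSingle_eq_of_ne]
    rintro rfl
    exact h1 rfl
  · rfl

theorem map_eq_one_of_not_surjective (hlow : ∀ m < p, ∀ x : grp Q m, x = 1) {k : SimplexCategory}
    (θ : k ⟶ SimplexCategory.mk p)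
    (h : ¬ Function.Surjective (SimplexCategory.Hom.toOrderHom θ)) (x : grp Q p) :
    (Q.map θ.op).hom x = 1 := by
  cases p with
  | zero =>
    refine absurd (fun y => ⟨0, ?_⟩) h
    exact Subsingleton.elim (α := Fin 1) _ _
  | succ p =>
    obtain ⟨i, θ', rfl⟩ := SimplexCategory.eq_comp_δ_of_not_surjective θ h
    rw [op_comp, Q.map_comp]
    exact (congrArg (Q.map θ'.op).hom (hlow p (Nat.lt_succ_self p) _)).trans (map_one _)

/-- The morphism from the Eilenberg–Mac Lane simplicial group to `Q` given by a homomorphism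
`A → Q_p`. -/
def surjEMToSGrp (hlow : ∀ m < p, ∀ x : grp Q m, x = 1) (e : A →* grp Q p)
    (hc : ∀ m, ∀ x y : Q.obj m, Commute x y) : surjEM A p ⟶ Q where
  app m := GrpCat.ofHom (surjEMHom e hc m)
  naturality m k f := by
    classical
    refine GrpCat.hom_ext ?_
    change (surjEMHom e hc k).comp (surjMap A p f.unop) =
      (Q.map f).hom.comp (surjEMHom e hc m)
    -- On the factor of σ both sides are the operator of the composite of `f.unop` with σ; if that
    -- composite is not surjective, the operator passes through a trivial group.
    refine MonoidHom.pi_ext fun σ a => ?_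
    rw [MonoidHom.comp_apply, MonoidHom.comp_apply, surjEMHom_mulSingle, surjMap_mulSingle]
    have h1 : (Q.map f).hom ((Q.map σ.1.op).hom (e a)) = (Q.map (f.unop ≫ σ.1).op).hom (e a) := by
      rw [op_comp, Q.map_comp]
      rfl
    rw [h1]
    split_ifs with h
    · rw [surjEMHom_mulSingle]
    · rw [map_one, map_eq_one_of_not_surjective hlow _ h]

/-- A simplicial group whose Moore complex is `A` concentrated in degree `p` is isomorphic to the
standard Eilenberg–Mac Lane simplicial group. -/
theorem nonempty_iso_eilenbergMacLane (hlow : ∀ m < p, ∀ x : grp Q m, x = 1)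
    (hQ : MooreTrivialAbove p Q) (e : A ≃* grp Q p) : Nonempty (Q ≅ EilenbergMacLane A p) := by
  have hc := commute_of_moore_concentrated hlow hQ fun x y => by
    rw [← e.apply_symm_apply x, ← e.apply_symm_apply y]
    exact (Commute.all _ _).map e
  obtain ⟨i⟩ := nonempty_surjEM_iso A p
  have hiso : IsIso (surjEMToSGrp hlow e.toMonoidHom hc) := by
    refine isIso_of_bijective _ (mooreTrivialAbove_surjEM A p) hQ fun m hm => ?_
    change Function.Bijective (surjEMHom e.toMonoidHom hc (op (SimplexCategory.mk m)))
    -- In degree p the only surjection is the identity, so the map is `e`; below p both groups are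
    -- trivial.
    rcases hm.eq_or_lt with rfl | hlt
    · classical
      have h1 : ∀ f : Surj (SimplexCategory.mk m) m → A,
          surjEMHom e.toMonoidHom hc (op (SimplexCategory.mk m)) f = e (f (Surj.one m)) := by
        intro f
        have hf : f = Pi.mulSingle (Surj.one m) (f (Surj.one m)) := funext fun σ => by
          rw [Surj.eq_one σ, Pi.mulSingle_eq_same]
        refine (congrArg _ hf).trans ((surjEMHom_mulSingle _ _ _ _ _).trans ?_)
        change (Q.map (𝟙 _)).hom _ = _
        rw [Q.map_id]
        rfl
      refine ⟨fun f g hfg => funext fun σ => ?_, fun x => ⟨fun _ => e.symm x, ?_⟩⟩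
      · rw [Surj.eq_one σ]
        exact e.injective ((h1 f).symm.trans (hfg.trans (h1 g)))
      · exact (h1 _).trans (e.apply_symm_apply x)
    · have := Surj.isEmpty hlt
      exact ⟨fun f g _ => funext fun σ => this.elim σ, fun x => ⟨1, by
        rw [map_one]; exact (hlow m hlt x).symm⟩⟩
  exact ⟨(asIso (surjEMToSGrp hlow e.toMonoidHom hc)).symm ≪≫ i⟩

/-- A simplicial group with Moore complex concentrated in degree `p` equals its homotopy group in
that degree. -/
def homotopyGroupEquiv (hlow : ∀ m < p, ∀ x : grp Q m, x = 1) (hQ : MooreTrivialAbove p Q) :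
    homotopyGroup Q p ≃* grp Q p :=
  have h1 : cycles Q p = ⊤ := by
    cases p with
    | zero => rfl
    | succ p =>
      exact (Subgroup.eq_top_iff' _).2 fun x =>
        ⟨mem_moore_succ.2 fun i => hlow p (Nat.lt_succ_self p) _, hlow p (Nat.lt_succ_self p) _⟩
  have h2 : (boundaries Q p).subgroupOf (cycles Q p) = ⊥ := by
    rw [boundaries, hQ _ (Nat.lt_succ_self p), Subgroup.map_bot, Subgroup.bot_subgroupOf]
  ((QuotientGroup.quotientMulEquivOfEq h2).trans QuotientGroup.quotientBot).trans
    ((MulEquiv.subgroupCongr h1).trans Subgroup.topEquiv)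

end Recognition

/-! ### Subquotients concentrated in one degree -/

theorem subquotient_eq_one {X : SGrp.{u}} {σ τ : NormalSub X} (h : τ ≤ σ) {m : ℕ}
    (hσ : ∀ x : grp X m, x ∈ σ.sub (op (SimplexCategory.mk m)) → x = 1)
    (q : grp (σ.subquotient τ h) m) : q = 1 := by
  obtain ⟨x, rfl⟩ := NormalSub.mkSub_surjective h q
  rw [show x = 1 from Subtype.ext (hσ _ x.2), map_one]

theorem mooreTrivialAbove_piGELE (n m : ℕ) (h : n ≤ m) (X : SGrp.{u}) :
    MooreTrivialAbove m (piGELE n m h X) := by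
  intro i hi
  refine (Subgroup.eq_bot_iff_forall _).2 fun q hq => ?_
  obtain ⟨x, hx, rfl⟩ := (mem_moore_subquotient _).1 hq
  exact (NormalSub.mkSub_eq_one _).2 (moore_le_muLE hi X hx)

end SimpGrp

end

theorem mainTheorem4 (n : ℕ) (X : SimpGrp.SGrp.{u}) :
    SimpGrp.IsEilenbergMacLane (SimpGrp.homotopyGroup X (n + 1)) (n + 1)
        (SimpGrp.piLEGE n (n + 2) (Nat.le_succ (n + 1)) X) ∧
      SimpGrp.IsEilenbergMacLane (SimpGrp.homotopyGroup X (n + 1)) (n + 1)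
        (SimpGrp.piLELE n (n + 1) (Nat.le_succ n) X) ∧
      SimpGrp.IsEilenbergMacLane (SimpGrp.homotopyGroup X (n + 1)) (n + 1)
        (SimpGrp.piGEGE (n + 1) (n + 2) (Nat.le_succ (n + 1)) X) ∧
      SimpGrp.IsEilenbergMacLane (SimpGrp.homotopyGroup X (n + 1)) (n + 1)
        (SimpGrp.piGELE (n + 1) (n + 1) le_rfl X) ∧
      Nonempty (SimpGrp.piGELE (n + 1) (n + 1) le_rfl X ≅
        SimpGrp.EilenbergMacLane (SimpGrp.homotopyGroup X (n + 1)) (n + 1)) := by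
  have hLE := fun (m : ℕ) (hm : n + 1 ≤ m) (x : SimpGrp.grp X (m + 1))
    (hx : x ∈ SimpGrp.moore X (m + 1)) (_ : SimpGrp.face X (Fin.last (m + 1)) x ∈
      (SimpGrp.muLE (n + 1) X).sub (op (SimplexCategory.mk m))) =>
    SimpGrp.moore_le_muLE (Nat.lt_succ_of_le hm) X hx
  -- Kept apart because its isomorphism on π_{n+1} also identifies the coefficient group in the
  -- final clause.
  have h4 := SimpGrp.isEilenbergMacLane_subquotient
    ((SimpGrp.muLE_anti le_rfl X).trans (SimpGrp.muLE_le_muGE (n + 1) X)) n le_rfl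
    (SimpGrp.muGE_succ_le_muLE n X) (SimpGrp.exists_face_eq_of_mem_muGE n X) le_rfl hLE
  refine ⟨SimpGrp.isEilenbergMacLane_subquotient _ n (SimpGrp.muGE_succ_le_muLE n X) le_rfl
      (SimpGrp.exists_face_eq_of_mem_muLE n X) (SimpGrp.muGE_succ_le_muLE (n + 1) X)
      (SimpGrp.mem_muGE_of_face_mem (n + 1) X),
    SimpGrp.isEilenbergMacLane_subquotient _ n (SimpGrp.muGE_succ_le_muLE n X) le_rfl
      (SimpGrp.exists_face_eq_of_mem_muLE n X) le_rfl hLE,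
    SimpGrp.isEilenbergMacLane_subquotient _ n le_rfl (SimpGrp.muGE_succ_le_muLE n X)
      (SimpGrp.exists_face_eq_of_mem_muGE n X) (SimpGrp.muGE_succ_le_muLE (n + 1) X)
      (SimpGrp.mem_muGE_of_face_mem (n + 1) X), h4, ?_⟩
  have hlow : ∀ m < n + 1, ∀ q : SimpGrp.grp (SimpGrp.piGELE (n + 1) (n + 1) le_rfl X) m, q = 1 :=
    fun m hm => SimpGrp.subquotient_eq_one _ fun _ hx => SimpGrp.muGE_eq_one hm hx
  have hQ := SimpGrp.mooreTrivialAbove_piGELE (n + 1) (n + 1) le_rfl X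
  obtain ⟨⟨e⟩, _⟩ := h4
  -- The quotient is trivial below n + 1 with Moore complex trivial above, so its group in degree n
  -- + 1 is its own π_{n+1}, and thus that of X.
  exact SimpGrp.nonempty_iso_eilenbergMacLane hlow hQ
    (e.symm.trans (SimpGrp.homotopyGroupEquiv hlow hQ))
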